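/- Rings, algebras and homomorphisms are associative but not necessarily unital. Let $F$ be an infinite field, $R$ an $F$-algebra, and $(P,Q,\psi)$ an $R$-system over the $F$-algebra $R$: $P$ and $Q$ are $R$-bimodules that are $F$-vector spaces with $\lambda(rm)=(\lambda r)m=r(\lambda m)$ and $\lambda(mr)=(\lambda m)r=m(\lambda r)$ for $\lambda\in F$, $r\in R$ and $m\in P$ or $m\in Q$, and $\psi:P\otimes_R Q\to R$ is an $R$-bimodule homomorphism. Let $\theta_{q,p}\in\mathrm{End}(Q)$ be $x\mapsto q\,\psi(p\otimes x)$ and $\theta_{p,q}\in\mathrm{End}(P)$ be $y\mapsto\psi(y\otimes q)\,p$, with additive spans $\mathcal F_P(Q)$ and $\mathcal F_Q(P)$. Assume condition (FS): for all finite sets $\{q_i\}\subseteq Q$ and $\{p_j\}\subseteq P$ there are $\Theta\in\mathcal F_P(Q)$ and $\Omega\in\mathcal F_Q(P)$ with $\Theta(q_i)=q_i$ and $\Omega(p_j)=p_j$ for all $i,j$. Let $\Delta(r)\in\mathrm{End}(Q)$ be $q\mapsto rq$. A two-sided ideal $J$ of $R$ is $\psi$-compatible if $\Delta(J)\subseteq\mathcal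 F_P(Q)$, and faithful if moreover $J\cap\ker\Delta=0$. A covariant representation $(S,T,\sigma,B)$ consists of a ring $B$, additive maps $S:P\to B$, $T:Q\to B$ and a ring homomorphism $\sigma:R\to B$ that turn the bimodule structures into multiplication in $B$ (so $S(pr)=S(p)\sigma(r)$, etc.) and satisfy $\sigma(\psi(p\otimes q))=S(p)T(q)$. Let $(\iota_P,\iota_Q,\iota_R,\mathcal T)$ be the universal one ($\mathcal T$ is the Toeplitz ring), and let $\pi:\mathcal F_P(Q)\to\mathcal T$ be the additive map with $\pi(\theta_{q,p})=\iota_Q(q)\iota_P(p)$, which is well defined under (FS). Put $\mathcal O(J)=\mathcal T/\mathcal T(J)$, where $\mathcal T(J)$ is the two-sided ideal generated by $\{\iota_R(x)-\pi(\Delta(x)):x\in J\}$, and let $\iota_R^J,\iota_P^J,\iota_Q^J$ be the induced maps into $\mathcal O(J)$. If $J$ is an $F$-subspace, then $\mathcal O(J)$ is an $F$-algebra for which these maps are $F$-linear, and it carries the gauge action $\tau^J:F^*\to\mathrm{Aut}_F(\mathcal O(J))$ determined by $\tau^J_t(\iota_R^J(r))=\iota_R^J(r)$, $\tau^J_t(\iota_P^J(p))=t\,\iota_P^J(p)$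 and $\tau^J_t(\iota_Q^J(q))=t^{-1}\iota_Q^J(q)$. Let $A$ be an $F$-algebra. 1. Let $J$ be a faithful $\psi$-compatible two-sided ideal of $R$ that is an $F$-subspace and is maximal among such ideals. Let $\phi:\mathcal O(J)\to A$ be an $F$-algebra homomorphism with $\phi(\iota_R^J(r))\neq0$ for all $r\in R\setminus\{0\}$. If there is a group action $\sigma:F^*\to\mathrm{Aut}_F(A)$ with $\phi\circ\tau^J_t=\sigma_t\circ\phi$ for all $t\in F^*$, then $\phi$ is injective. 2. (Gauge-Invariant Uniqueness Theorem for Cuntz–Pimsner rings.) Suppose that $R$ has a uniquely maximal faithful $\psi$-compatible two-sided ideal $J$, i.e. a faithful $\psi$-compatible two-sided ideal that contains every faithful $\psi$-compatible two-sided ideal. (Such a $J$ is automatically an $F$-subspace.) Let $\mathcal O_{(P,Q,\psi)}=\mathcal O(J)$ be the Cuntz–Pimsner ring, $p_r=\iota_R^J(r)$ and $\tau^{CP}=\tau^J$. Let $\phi:\mathcal O_{(P,Q,\psi)}\to A$ be an $F$-algebra homomorphism with $\phi(p_r)\neq0$ for all $r\in R\setminus\{0\}$. If there is a group action $\sigma:F^*\to\mathrm{Aut}_F(A)$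 with $\phi\circ\tau^{CP}_t=\sigma_t\circ\phi$ for all $t\in F^*$, then $\phi$ is injective. -/

import Mathlib

set_option linter.unusedSectionVars false

open scoped RightActions

/-! ### Bimodules and systems over a (not necessarily unital) ring -/

/-- `M` is an `R`-bimodule, for an associative ring `R` that need not have a unit.
The left action is written `r • m` and the right action `m <• r`. -/
class NUBimodule (R M : Type*) [NonUnitalRing R] [AddCommGroup M] extends
    SMul R M where
  [toOpSMul : SMul Rᵐᵒᵖ M]
  lsmul_add : ∀ (r : R) (m n : M), r • (m + n) = r • m + r • n
  add_lsmul : ∀ (r s : R) (m : M), (r + s) • m = r • m + s • m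
  mul_lsmul : ∀ (r s : R) (m : M), (r * s) • m = r • (s • m)
  rsmul_add : ∀ (r : R) (m n : M), (m + n) <• r = m <• r + n <• r
  add_rsmul : ∀ (r s : R) (m : M), m <• (r + s) = m <• r + m <• s
  mul_rsmul : ∀ (r s : R) (m : M), m <• (r * s) = (m <• r) <• s
  lsmul_rsmul : ∀ (r s : R) (m : M), (r • m) <• s = r • (m <• s)

attribute [reducible, instance] NUBimodule.toOpSMul

/-- An `R`-system `(P, Q, ψ)`.  A bimodule homomorphism `P ⊗ Q → R` out of the `R`-balanced tensor
product is given as a biadditive `R`-balanced map that is left and right `R`-linear. -/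
structure RSystem (R P Q : Type*) [NonUnitalRing R] [AddCommGroup P] [AddCommGroup Q]
    [NUBimodule R P] [NUBimodule R Q] where
  ψ : P →+ Q →+ R
  balanced : ∀ (p : P) (r : R) (q : Q), ψ (p <• r) q = ψ p (r • q)
  map_lsmul : ∀ (r : R) (p : P) (q : Q), ψ (r • p) q = r * ψ p q
  map_rsmul : ∀ (p : P) (q : Q) (r : R), ψ p (q <• r) = ψ p q * r

namespace RSystem

section Ring

variable {R P Q : Type*} [NonUnitalRing R] [AddCommGroup P] [AddCommGroup Q]
  [NUBimodule R P] [NUBimodule R Q] (𝒮 : RSystem R P Q)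

/-- A covariant representation `(S, T, σ, B)` of an `R`-system on the ring `B`. -/
structure CovRep (B : Type*) [NonUnitalRing B] where
  S : P →+ B
  T : Q →+ B
  σ : R →ₙ+* B
  S_rsmul : ∀ p r, S (p <• r) = S p * σ r
  S_lsmul : ∀ r p, S (r • p) = σ r * S p
  T_rsmul : ∀ q r, T (q <• r) = T q * σ r
  T_lsmul : ∀ r q, T (r • q) = σ r * T q
  cov : ∀ p q, σ (𝒮.ψ p q) = S p * T q

/-- The rank one homomorphism `θ_{q,p} : x ↦ q ψ(p ⊗ x)` of `Q`. -/
def theta (q : Q) (p : P) : Q →+ Q where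
  toFun x := q <• 𝒮.ψ p x
  map_zero' := by
    have h := NUBimodule.add_rsmul (0 : R) 0 q
    simp only [add_zero] at h
    simpa using h
  map_add' x y := by rw [map_add, NUBimodule.add_rsmul]

/-- The rank one homomorphism `θ_{p,q} : y ↦ ψ(y ⊗ q) p` of `P`. -/
def thetaAdj (p : P) (q : Q) : P →+ P where
  toFun y := 𝒮.ψ y q • p
  map_zero' := by
    have h := NUBimodule.add_lsmul (0 : R) 0 p
    simp only [add_zero] at h
    simpa using h
  map_add' x y := by rw [map_add, AddMonoidHom.add_apply, NUBimodule.add_lsmul]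

/-- `𝓕_P(Q)`: the additive span of the `θ_{q,p}`. -/
def finRank : AddSubgroup (Q →+ Q) :=
  AddSubgroup.closure {Θ | ∃ q p, Θ = 𝒮.theta q p}

/-- `𝓕_Q(P)`: the additive span of the `θ_{p,q}`. -/
def finRankAdj : AddSubgroup (P →+ P) :=
  AddSubgroup.closure {Θ | ∃ p q, Θ = 𝒮.thetaAdj p q}

/-- Condition **(FS)**: any finitely many elements of `Q` are fixed by one element of `𝓕_P(Q)`, and
any finitely many elements of `P` by one element of `𝓕_Q(P)`. -/
class FS : Prop where
  exists_finRank : ∀ (s : Finset Q) (t : Finset P), ∃ Θ ∈ 𝒮.finRank, ∃ Ω ∈ 𝒮.finRankAdj,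
    (∀ q ∈ s, Θ q = q) ∧ ∀ p ∈ t, Ω p = p

/-- `Δ(r)`: left multiplication by `r` on `Q`. -/
def Delta (_ : RSystem R P Q) (r : R) : Q →+ Q where
  toFun q := r • q
  map_zero' := by
    have h := NUBimodule.lsmul_add r (0 : Q) 0
    simpa using h
  map_add' x y := NUBimodule.lsmul_add r x y

/-- `J ⊆ Δ⁻¹(𝓕_P(Q))`. -/
def IsCompatible (J : TwoSidedIdeal R) : Prop := ∀ x ∈ J, 𝒮.Delta x ∈ 𝒮.finRank

/-- A `ψ`-compatible two-sided ideal with `J ∩ ker Δ = 0`. -/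
def IsFaithfulCompatible (J : TwoSidedIdeal R) : Prop :=
  𝒮.IsCompatible J ∧ ∀ x ∈ J, 𝒮.Delta x = 0 → x = 0

/-- A uniquely maximal faithful `ψ`-compatible two-sided ideal: it contains every other one. -/
def IsUniquelyMaximal (J : TwoSidedIdeal R) : Prop :=
  𝒮.IsFaithfulCompatible J ∧ ∀ J' : TwoSidedIdeal R, 𝒮.IsFaithfulCompatible J' → J' ≤ J

/-! ### The representation of the finite rank homomorphisms -/

variable {𝒮}

/-- The additive map on formal sums of pairs `(q, p)` with `(q, p) ↦ θ_{q,p}`. -/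
noncomputable def thetaSum (𝒮 : RSystem R P Q) : FreeAbelianGroup (Q × P) →+ Q →+ Q :=
  FreeAbelianGroup.lift fun x => 𝒮.theta x.1 x.2

theorem thetaSum_mem (z : FreeAbelianGroup (Q × P)) : 𝒮.thetaSum z ∈ 𝒮.finRank := by
  induction z using FreeAbelianGroup.induction_on with
  | zero => rw [map_zero]; exact zero_mem _
  | of x =>
    rw [thetaSum, FreeAbelianGroup.lift_apply_of]
    exact AddSubgroup.subset_closure ⟨_, _, rfl⟩
  | neg x h => rw [map_neg]; exact neg_mem h
  | add x y hx hy => rw [map_add]; exact add_mem hx hy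

/-- `thetaSum` with codomain `𝓕_P(Q)`. -/
noncomputable def thetaSum' (𝒮 : RSystem R P Q) : FreeAbelianGroup (Q × P) →+ 𝒮.finRank :=
  𝒮.thetaSum.codRestrict 𝒮.finRank thetaSum_mem

theorem thetaSum'_surjective : Function.Surjective 𝒮.thetaSum' := by
  rintro ⟨Θ, hΘ⟩
  suffices h : ∃ z, 𝒮.thetaSum z = Θ by
    obtain ⟨z, hz⟩ := h
    exact ⟨z, Subtype.ext hz⟩
  induction hΘ using AddSubgroup.closure_induction with
  | mem x hx =>
    obtain ⟨q, p, rfl⟩ := hx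
    exact ⟨FreeAbelianGroup.of (q, p), by rw [thetaSum, FreeAbelianGroup.lift_apply_of]⟩
  | zero => exact ⟨0, map_zero _⟩
  | add x y _ _ hx hy =>
    obtain ⟨a, rfl⟩ := hx
    obtain ⟨b, rfl⟩ := hy
    exact ⟨a + b, map_add _ _ _⟩
  | neg x _ hx =>
    obtain ⟨a, rfl⟩ := hx
    exact ⟨-a, map_neg _ _⟩

namespace CovRep

variable {B : Type*} [NonUnitalRing B] (c : 𝒮.CovRep B)

/-- The additive map on formal sums with `(q, p) ↦ T(q) S(Ω p)`. -/
noncomputable def piSum (Ω : P →+ P) : FreeAbelianGroup (Q × P) →+ B :=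
  FreeAbelianGroup.lift fun x => c.T x.1 * c.S (Ω x.2)

theorem piSum_add (Ω Ω' : P →+ P) (z : FreeAbelianGroup (Q × P)) :
    c.piSum (Ω + Ω') z = c.piSum Ω z + c.piSum Ω' z := by
  induction z using FreeAbelianGroup.induction_on with
  | zero => simp
  | of x => simp [piSum, mul_add]
  | neg x h => rw [map_neg, map_neg, map_neg, h]; abel
  | add x y hx hy => rw [map_add, map_add, map_add, hx, hy]; abel

theorem piSum_thetaAdj (e : P) (f : Q) (z : FreeAbelianGroup (Q × P)) :
    c.piSum (𝒮.thetaAdj e f) z = c.T (𝒮.thetaSum z f) * c.S e := by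
  induction z using FreeAbelianGroup.induction_on with
  | zero => simp
  | of x =>
    simp only [piSum, thetaSum, FreeAbelianGroup.lift_apply_of]
    change c.T x.1 * c.S (𝒮.ψ x.2 f • e) = c.T (x.1 <• 𝒮.ψ x.2 f) * c.S e
    rw [c.S_lsmul, c.T_rsmul, mul_assoc]
  | neg x h => rw [map_neg, map_neg, h, AddMonoidHom.neg_apply, map_neg, neg_mul]
  | add x y hx hy => rw [map_add, map_add, hx, hy, AddMonoidHom.add_apply, map_add, add_mul]

theorem piSum_eq_zero {Ω : P →+ P} (hΩ : Ω ∈ 𝒮.finRankAdj)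
    {z : FreeAbelianGroup (Q × P)} (hz : 𝒮.thetaSum z = 0) : c.piSum Ω z = 0 := by
  induction hΩ using AddSubgroup.closure_induction with
  | mem x hx =>
    obtain ⟨e, f, rfl⟩ := hx
    rw [piSum_thetaAdj, hz, AddMonoidHom.zero_apply, map_zero, zero_mul]
  | zero =>
    have h := c.piSum_add 0 0 z
    simp only [add_zero] at h
    simpa using h
  | add x y _ _ hx hy => rw [piSum_add, hx, hy, add_zero]
  | neg x _ hx =>
    have h := c.piSum_add (-x) x z
    have h0 : c.piSum 0 z = 0 := by
      have h := c.piSum_add 0 0 z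
      simp only [add_zero] at h
      simpa using h
    rw [neg_add_cancel, h0, hx, add_zero] at h
    exact h.symm

theorem exists_piSum_eq (z : FreeAbelianGroup (Q × P)) :
    ∃ t : Finset P, ∀ Ω : P →+ P, (∀ p ∈ t, Ω p = p) → c.piSum Ω z = c.piSum (.id P) z := by
  classical
  induction z using FreeAbelianGroup.induction_on with
  | zero => exact ⟨∅, fun Ω _ => by simp⟩
  | of x => exact ⟨{x.2}, fun Ω h => by simp [piSum, h x.2 (Finset.mem_singleton_self _)]⟩
  | neg x h =>
    obtain ⟨t, ht⟩ := h
    exact ⟨t, fun Ω h => by rw [map_neg, map_neg, ht Ω h]⟩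
  | add x y hx hy =>
    obtain ⟨t, ht⟩ := hx
    obtain ⟨u, hu⟩ := hy
    exact ⟨t ∪ u, fun Ω h => by
      rw [map_add, map_add, ht Ω fun p hp => h p (Finset.mem_union_left _ hp),
        hu Ω fun p hp => h p (Finset.mem_union_right _ hp)]⟩

theorem ker_thetaSum'_le [h𝒮 : 𝒮.FS] : 𝒮.thetaSum'.ker ≤ (c.piSum (.id P)).ker := by
  intro z hz
  have hz' : 𝒮.thetaSum z = 0 := congrArg Subtype.val (AddMonoidHom.mem_ker.1 hz)
  obtain ⟨t, ht⟩ := c.exists_piSum_eq z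
  obtain ⟨-, -, Ω, hΩ, -, h⟩ := h𝒮.exists_finRank ∅ t
  rw [AddMonoidHom.mem_ker, ← ht Ω h, c.piSum_eq_zero hΩ hz']

/-- The map `π_{T,S} : 𝓕_P(Q) → B`; it is determined by `pi_theta` below. -/
noncomputable def pi [𝒮.FS] : 𝒮.finRank →+ B :=
  𝒮.thetaSum'.liftOfRightInverse (Function.surjInv thetaSum'_surjective)
    (Function.rightInverse_surjInv _) ⟨c.piSum (.id P), c.ker_thetaSum'_le⟩

theorem pi_thetaSum' [𝒮.FS] (z : FreeAbelianGroup (Q × P)) :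
    c.pi (𝒮.thetaSum' z) = c.piSum (.id P) z :=
  AddMonoidHom.liftOfRightInverse_comp_apply _ _ _ ⟨c.piSum (.id P), c.ker_thetaSum'_le⟩ z

theorem theta_mem (𝒮 : RSystem R P Q) (q : Q) (p : P) : 𝒮.theta q p ∈ 𝒮.finRank :=
  AddSubgroup.subset_closure ⟨q, p, rfl⟩

/-- `π_{T,S}(θ_{q,p}) = T(q) S(p)`. -/
theorem pi_theta [𝒮.FS] (q : Q) (p : P) :
    c.pi ⟨𝒮.theta q p, theta_mem 𝒮 q p⟩ = c.T q * c.S p := by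
  have h : 𝒮.thetaSum' (FreeAbelianGroup.of (q, p)) = ⟨𝒮.theta q p, theta_mem 𝒮 q p⟩ :=
    Subtype.ext (by
      change 𝒮.thetaSum _ = _
      rw [thetaSum, FreeAbelianGroup.lift_apply_of])
  rw [← h, pi_thetaSum', piSum, FreeAbelianGroup.lift_apply_of]
  rfl

end CovRep

/-! ### The Toeplitz ring -/

variable (R P Q) in
/-- Generators of the Toeplitz ring. -/
inductive Gen
  | ofR (r : R)
  | ofP (p : P)
  | ofQ (q : Q)

variable (R P Q) in
/-- The free (non-unital, associative) ring on the generators. -/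
abbrev FreeRg := MonoidAlgebra ℤ (FreeSemigroup (Gen R P Q))

/-- A generator as an element of the free ring. -/
noncomputable def gen (x : Gen R P Q) : FreeRg R P Q :=
  MonoidAlgebra.single (FreeSemigroup.of x) 1

/-- The defining relators: those of a covariant representation. -/
inductive Rel (𝒮 : RSystem R P Q) : FreeRg R P Q → Prop
  | addR (r s : R) : Rel 𝒮 (gen (.ofR (r + s)) - (gen (.ofR r) + gen (.ofR s)))
  | addP (p p' : P) : Rel 𝒮 (gen (.ofP (p + p')) - (gen (.ofP p) + gen (.ofP p')))
  | addQ (q q' : Q) : Rel 𝒮 (gen (.ofQ (q + q')) - (gen (.ofQ q) + gen (.ofQ q')))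
  | mulR (r s : R) : Rel 𝒮 (gen (.ofR (r * s)) - gen (.ofR r) * gen (.ofR s))
  | rsmulP (p : P) (r : R) : Rel 𝒮 (gen (.ofP (p <• r)) - gen (.ofP p) * gen (.ofR r))
  | lsmulP (r : R) (p : P) : Rel 𝒮 (gen (.ofP (r • p)) - gen (.ofR r) * gen (.ofP p))
  | rsmulQ (q : Q) (r : R) : Rel 𝒮 (gen (.ofQ (q <• r)) - gen (.ofQ q) * gen (.ofR r))
  | lsmulQ (r : R) (q : Q) : Rel 𝒮 (gen (.ofQ (r • q)) - gen (.ofR r) * gen (.ofQ q))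
  | cov (p : P) (q : Q) : Rel 𝒮 (gen (.ofR (𝒮.ψ p q)) - gen (.ofP p) * gen (.ofQ q))

/-- The quotient map of a ring by a two-sided ideal. -/
def idealMk {A : Type*} [NonUnitalRing A] (I : TwoSidedIdeal A) : A →ₙ+* I.ringCon.Quotient where
  toFun x := (x : I.ringCon.Quotient)
  map_mul' _ _ := rfl
  map_zero' := rfl
  map_add' _ _ := rfl

theorem idealMk_eq_zero {A : Type*} [NonUnitalRing A] (I : TwoSidedIdeal A) {x : A} :
    idealMk I x = 0 ↔ x ∈ I :=
  (I.ringCon.eq).trans (I.mem_iff x).symm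

theorem idealMk_surjective {A : Type*} [NonUnitalRing A] (I : TwoSidedIdeal A) :
    Function.Surjective (idealMk I) := fun x => Quotient.inductionOn' x fun a => ⟨a, rfl⟩

/-- A ring homomorphism that vanishes on a two-sided ideal factors through the quotient. -/
def idealLift {A B : Type*} [NonUnitalRing A] [NonUnitalRing B] (I : TwoSidedIdeal A)
    (f : A →ₙ+* B) (h : ∀ x ∈ I, f x = 0) : I.ringCon.Quotient →ₙ+* B where
  toFun x := Quotient.liftOn' x f fun a b hab => by
    have := h _ ((I.rel_iff a b).1 hab)
    rwa [map_sub, sub_eq_zero] at this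
  map_mul' x y := Quotient.inductionOn₂' x y fun a b => map_mul f a b
  map_zero' := map_zero f
  map_add' x y := Quotient.inductionOn₂' x y fun a b => map_add f a b

/-- The Toeplitz ring `𝒯_{(P,Q,ψ)}`: the universal ring of covariant representations
(see `toeplitzLift` and `Toeplitz.hom_ext`). -/
def Toeplitz (𝒮 : RSystem R P Q) : Type _ :=
  (TwoSidedIdeal.span {x | Rel 𝒮 x}).ringCon.Quotient

noncomputable instance : NonUnitalRing 𝒮.Toeplitz :=
  inferInstanceAs (NonUnitalRing (TwoSidedIdeal.span {x | Rel 𝒮 x}).ringCon.Quotient)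

/-- The quotient map from the free ring. -/
noncomputable def toToeplitz (𝒮 : RSystem R P Q) : FreeRg R P Q →ₙ+* 𝒮.Toeplitz :=
  idealMk (TwoSidedIdeal.span {x | Rel 𝒮 x})

theorem toToeplitz_eq {x y : FreeRg R P Q} (h : Rel 𝒮 (x - y)) :
    𝒮.toToeplitz x = 𝒮.toToeplitz y := by
  rw [← sub_eq_zero, ← map_sub]
  exact (idealMk_eq_zero _).2 (TwoSidedIdeal.subset_span h)

/-- The Toeplitz representation `(ι_P, ι_Q, ι_R, 𝒯_{(P,Q,ψ)})`. -/
noncomputable def toeplitzRep (𝒮 : RSystem R P Q) : 𝒮.CovRep 𝒮.Toeplitz where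
  S := AddMonoidHom.mk' (fun p => 𝒮.toToeplitz (gen (.ofP p))) fun a b =>
    (toToeplitz_eq (.addP a b)).trans (map_add _ _ _)
  T := AddMonoidHom.mk' (fun q => 𝒮.toToeplitz (gen (.ofQ q))) fun a b =>
    (toToeplitz_eq (.addQ a b)).trans (map_add _ _ _)
  σ :=
    { AddMonoidHom.mk' (fun r => 𝒮.toToeplitz (gen (.ofR r))) fun a b =>
        (toToeplitz_eq (.addR a b)).trans (map_add _ _ _) with
      map_mul' := fun a b => (toToeplitz_eq (.mulR a b)).trans (map_mul _ _ _) }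
  S_rsmul p r := (toToeplitz_eq (.rsmulP p r)).trans (map_mul _ _ _)
  S_lsmul r p := (toToeplitz_eq (.lsmulP r p)).trans (map_mul _ _ _)
  T_rsmul q r := (toToeplitz_eq (.rsmulQ q r)).trans (map_mul _ _ _)
  T_lsmul r q := (toToeplitz_eq (.lsmulQ r q)).trans (map_mul _ _ _)
  cov p q := (toToeplitz_eq (.cov p q)).trans (map_mul _ _ _)

section lift

variable {B : Type*} [NonUnitalRing B]

/-- A covariant representation on the generators. -/
def CovRep.onGen (c : 𝒮.CovRep B) : Gen R P Q → B
  | .ofR r => c.σ r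
  | .ofP p => c.S p
  | .ofQ q => c.T q

/-- The extension to the free ring. -/
noncomputable def CovRep.freeLift (c : 𝒮.CovRep B) : FreeRg R P Q →ₙ+* B :=
  (MonoidAlgebra.liftMagma ℤ (FreeSemigroup.lift c.onGen) : FreeRg R P Q →ₙₐ[ℤ] B)

theorem CovRep.freeLift_gen (c : 𝒮.CovRep B) (x : Gen R P Q) :
    c.freeLift (gen x) = c.onGen x := by
  change MonoidAlgebra.liftMagma ℤ (FreeSemigroup.lift c.onGen) (gen x) = _
  simp [gen]

/-- The homomorphism `η_{(S,T,σ,B)} : 𝒯_{(P,Q,ψ)} → B`. -/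
noncomputable def toeplitzLift (c : 𝒮.CovRep B) : 𝒮.Toeplitz →ₙ+* B :=
  idealLift (TwoSidedIdeal.span {x | Rel 𝒮 x}) c.freeLift fun x hx => by
    rw [← TwoSidedIdeal.mem_ker]
    refine TwoSidedIdeal.span_le.2 ?_ hx
    intro y hy
    rw [SetLike.mem_coe, TwoSidedIdeal.mem_ker]
    induction hy <;>
      simp [CovRep.freeLift_gen, CovRep.onGen, c.S_rsmul, c.S_lsmul, c.T_rsmul, c.T_lsmul, c.cov]

@[simp] theorem toeplitzLift_R (c : 𝒮.CovRep B) (r : R) :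
    toeplitzLift c (𝒮.toeplitzRep.σ r) = c.σ r := c.freeLift_gen (.ofR r)

@[simp] theorem toeplitzLift_P (c : 𝒮.CovRep B) (p : P) :
    toeplitzLift c (𝒮.toeplitzRep.S p) = c.S p := c.freeLift_gen (.ofP p)

@[simp] theorem toeplitzLift_Q (c : 𝒮.CovRep B) (q : Q) :
    toeplitzLift c (𝒮.toeplitzRep.T q) = c.T q := c.freeLift_gen (.ofQ q)

/-- Induction on the Toeplitz ring. -/
theorem Toeplitz.induction {motive : 𝒮.Toeplitz → Prop}
    (R : ∀ r, motive (𝒮.toeplitzRep.σ r)) (P : ∀ p, motive (𝒮.toeplitzRep.S p))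
    (Q : ∀ q, motive (𝒮.toeplitzRep.T q)) (zero : motive 0)
    (add : ∀ x y, motive x → motive y → motive (x + y)) (neg : ∀ x, motive x → motive (-x))
    (mul : ∀ x y, motive x → motive y → motive (x * y)) (x : 𝒮.Toeplitz) : motive x := by
  have hgen : ∀ g : Gen _ _ _, motive (𝒮.toToeplitz (gen g))
    | .ofR r => R r
    | .ofP p => P p
    | .ofQ q => Q q
  have hw : ∀ w : FreeSemigroup (Gen _ _ _),
      motive (𝒮.toToeplitz (MonoidAlgebra.single w 1)) := by
    intro w
    induction w using FreeSemigroup.recOnMul with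
    | ih1 g => exact hgen g
    | ih2 g w hg hw' =>
      have h : (MonoidAlgebra.single (FreeSemigroup.of g * w) 1 : FreeRg _ _ _)
          = gen g * MonoidAlgebra.single w 1 := by
        simp [gen, MonoidAlgebra.single_mul_single]
      rw [h, map_mul]
      exact mul _ _ (hgen g) hw'
  obtain ⟨y, rfl⟩ := idealMk_surjective _ x
  change motive (𝒮.toToeplitz y)
  induction y using MonoidAlgebra.induction_linear with
  | zero => rw [map_zero]; exact zero
  | add a b ha hb => rw [map_add]; exact add _ _ ha hb
  | single w n =>
    induction n using Int.induction_on with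
    | zero => rw [MonoidAlgebra.single_zero, map_zero]; exact zero
    | succ n ih =>
      rw [MonoidAlgebra.single_add, map_add]
      exact add _ _ ih (hw w)
    | pred n ih =>
      rw [sub_eq_add_neg, MonoidAlgebra.single_add, map_add, MonoidAlgebra.single_neg w (1 : ℤ),
        map_neg 𝒮.toToeplitz (MonoidAlgebra.single w 1)]
      exact add _ _ ih (neg _ (hw w))

theorem Toeplitz.hom_ext {f g : 𝒮.Toeplitz →ₙ+* B}
    (hR : ∀ r, f (𝒮.toeplitzRep.σ r) = g (𝒮.toeplitzRep.σ r))
    (hP : ∀ p, f (𝒮.toeplitzRep.S p) = g (𝒮.toeplitzRep.S p))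
    (hQ : ∀ q, f (𝒮.toeplitzRep.T q) = g (𝒮.toeplitzRep.T q)) : f = g := by
  ext x
  induction x using Toeplitz.induction with
  | R r => exact hR r
  | P p => exact hP p
  | Q q => exact hQ q
  | zero => rw [map_zero, map_zero]
  | add x y hx hy => rw [map_add, map_add, hx, hy]
  | neg x hx => rw [map_neg, map_neg, hx]
  | mul x y hx hy => rw [map_mul, map_mul, hx, hy]

end lift

/-! ### Relative Cuntz–Pimsner rings -/

/-- The ideal `𝒯(J)` generated by the elements `ι_R(x) - π(Δ(x))` with `x ∈ J`. -/
noncomputable def toeplitzIdeal (𝒮 : RSystem R P Q) [𝒮.FS] (J : TwoSidedIdeal R) :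
    TwoSidedIdeal 𝒮.Toeplitz :=
  TwoSidedIdeal.span {y | ∃ x ∈ J, ∃ h : 𝒮.Delta x ∈ 𝒮.finRank,
    y = 𝒮.toeplitzRep.σ x - 𝒮.toeplitzRep.pi ⟨𝒮.Delta x, h⟩}

/-- The Cuntz–Pimsner ring `𝒪_{(P,Q,ψ)}(J)` relative to `J` (used for `ψ`-compatible `J`). -/
def RelCP (𝒮 : RSystem R P Q) [𝒮.FS] (J : TwoSidedIdeal R) : Type _ :=
  (𝒮.toeplitzIdeal J).ringCon.Quotient

noncomputable instance [𝒮.FS] (J : TwoSidedIdeal R) : NonUnitalRing (𝒮.RelCP J) :=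
  inferInstanceAs (NonUnitalRing (𝒮.toeplitzIdeal J).ringCon.Quotient)

variable (𝒮) [𝒮.FS]

/-- The quotient map `ρ_J`. -/
noncomputable def rho (J : TwoSidedIdeal R) : 𝒮.Toeplitz →ₙ+* 𝒮.RelCP J :=
  idealMk (𝒮.toeplitzIdeal J)

/-- `ι_R^J`. -/
noncomputable def iotaR (J : TwoSidedIdeal R) (r : R) : 𝒮.RelCP J := 𝒮.rho J (𝒮.toeplitzRep.σ r)

/-- `ι_P^J`. -/
noncomputable def iotaP (J : TwoSidedIdeal R) (p : P) : 𝒮.RelCP J := 𝒮.rho J (𝒮.toeplitzRep.S p)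

/-- `ι_Q^J`. -/
noncomputable def iotaQ (J : TwoSidedIdeal R) (q : Q) : 𝒮.RelCP J := 𝒮.rho J (𝒮.toeplitzRep.T q)

/-- The uniquely maximal faithful `ψ`-compatible ideal, when there is one. -/
noncomputable def cpIdeal (h : ∃ J, 𝒮.IsUniquelyMaximal J) : TwoSidedIdeal R := h.choose

/-- The Cuntz–Pimsner ring `𝒪_{(P,Q,ψ)}`. -/
abbrev CuntzPimsner (h : ∃ J, 𝒮.IsUniquelyMaximal J) : Type _ := 𝒮.RelCP (𝒮.cpIdeal h)

end Ring

/-! ### Systems over an algebra -/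

section Algebra

variable {F R P Q : Type*} [Field F] [NonUnitalRing R] [AddCommGroup P] [AddCommGroup Q]
  [NUBimodule R P] [NUBimodule R Q]
  [Module F R] [IsScalarTower F R R] [SMulCommClass F R R]
  [Module F P] [IsScalarTower F R P] [SMulCommClass F R P]
  [IsScalarTower F Rᵐᵒᵖ P] [SMulCommClass F Rᵐᵒᵖ P]
  [Module F Q] [IsScalarTower F R Q] [SMulCommClass F R Q]
  [IsScalarTower F Rᵐᵒᵖ Q] [SMulCommClass F Rᵐᵒᵖ Q]
  {𝒮 : RSystem R P Q}

/-- A two-sided ideal of an `F`-algebra that is an `F`-subspace.  Only for such `J` is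
`𝒪_{(P,Q,ψ)}(J)` an `F`-algebra with `F`-linear `ι_R^J`. -/
class IsSMulStable (F : Type*) {R : Type*} [Field F] [NonUnitalRing R] [Module F R]
    (J : TwoSidedIdeal R) : Prop where
  smul_mem : ∀ (c : F) (x : R), x ∈ J → c • x ∈ J

/-- `J` is maximal among the faithful `ψ`-compatible two-sided ideals of the `F`-algebra `R`
(ideals of the algebra being `F`-subspaces). -/
def IsMaximalFaithful (F : Type*) {R P Q : Type*} [Field F] [NonUnitalRing R] [AddCommGroup P]
    [AddCommGroup Q] [NUBimodule R P] [NUBimodule R Q] [Module F R] (𝒮 : RSystem R P Q)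
    (J : TwoSidedIdeal R) : Prop :=
  𝒮.IsFaithfulCompatible J ∧ ∀ J' : TwoSidedIdeal R, IsSMulStable F J' →
    𝒮.IsFaithfulCompatible J' → J ≤ J' → J = J'

/-- The group `Aut_F(A)` of `F`-algebra automorphisms of a (not necessarily unital) algebra. -/
def AlgAut (F A : Type*) [Field F] [NonUnitalRing A] [Module F A] : Subgroup (RingAut A) where
  carrier := {e | ∀ (c : F) (a : A), e (c • a) = c • e a}
  mul_mem' {e f} he hf c a := by
    change e (f (c • a)) = c • e (f a)
    rw [hf, he]
  one_mem' _ _ := rfl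
  inv_mem' {e} he c a := by
    change e.symm (c • a) = c • e.symm a
    rw [RingEquiv.symm_apply_eq, he, RingEquiv.apply_symm_apply]

theorem psi_smul_left [h𝒮 : 𝒮.FS] (c : F) (p : P) (q : Q) :
    𝒮.ψ (c • p) q = c • 𝒮.ψ p q := by
  obtain ⟨-, -, Ω, hΩ, -, h⟩ := h𝒮.exists_finRank ∅ {p}
  rw [← h p (Finset.mem_singleton_self p)]
  clear h
  induction hΩ using AddSubgroup.closure_induction with
  | mem x hx =>
    obtain ⟨e, f, rfl⟩ := hx
    change 𝒮.ψ (c • (𝒮.ψ p f • e)) q = c • 𝒮.ψ (𝒮.ψ p f • e) q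
    rw [← smul_assoc, 𝒮.map_lsmul, 𝒮.map_lsmul, smul_mul_assoc]
  | zero => simp
  | add x y _ _ hx hy => simp only [AddMonoidHom.add_apply, smul_add, map_add, hx, hy]
  | neg x _ hx => simp only [AddMonoidHom.neg_apply, smul_neg, map_neg, hx]

theorem psi_smul_right [h𝒮 : 𝒮.FS] (c : F) (p : P) (q : Q) :
    𝒮.ψ p (c • q) = c • 𝒮.ψ p q := by
  obtain ⟨Θ, hΘ, -, -, h, -⟩ := h𝒮.exists_finRank {q} ∅
  rw [← h q (Finset.mem_singleton_self q)]
  clear h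
  induction hΘ using AddSubgroup.closure_induction with
  | mem x hx =>
    obtain ⟨e, f, rfl⟩ := hx
    change 𝒮.ψ p (c • (e <• 𝒮.ψ f q)) = c • 𝒮.ψ p (e <• 𝒮.ψ f q)
    rw [← smul_assoc, ← MulOpposite.op_smul, 𝒮.map_rsmul, 𝒮.map_rsmul, mul_smul_comm]
  | zero => simp
  | add x y _ _ hx hy => simp only [AddMonoidHom.add_apply, smul_add, map_add, hx, hy]
  | neg x _ hx => simp only [AddMonoidHom.neg_apply, smul_neg, map_neg, hx]

/-! #### The `F`-algebra structure of the Toeplitz ring -/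

/-- The ring of pairs with multiplication `(x, d) (y, e) = (x y, d y)`; it is used to define
additive maps `D` on the Toeplitz ring with `D (x y) = D(x) y`. -/
@[ext] structure PairRing (B : Type*) where
  fst : B
  snd : B

namespace PairRing

variable {B : Type*} [NonUnitalRing B]

instance : Zero (PairRing B) := ⟨⟨0, 0⟩⟩
instance : Add (PairRing B) := ⟨fun x y => ⟨x.1 + y.1, x.2 + y.2⟩⟩
instance : Neg (PairRing B) := ⟨fun x => ⟨-x.1, -x.2⟩⟩
instance : Mul (PairRing B) := ⟨fun x y => ⟨x.1 * y.1, x.2 * y.1⟩⟩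

@[simp] theorem zero_fst : (0 : PairRing B).fst = 0 := rfl
@[simp] theorem zero_snd : (0 : PairRing B).snd = 0 := rfl
@[simp] theorem add_fst (x y : PairRing B) : (x + y).fst = x.fst + y.fst := rfl
@[simp] theorem add_snd (x y : PairRing B) : (x + y).snd = x.snd + y.snd := rfl
@[simp] theorem neg_fst (x : PairRing B) : (-x).fst = -x.fst := rfl
@[simp] theorem neg_snd (x : PairRing B) : (-x).snd = -x.snd := rfl
@[simp] theorem mul_fst (x y : PairRing B) : (x * y).fst = x.fst * y.fst := rfl
@[simp] theorem mul_snd (x y : PairRing B) : (x * y).snd = x.snd * y.fst := rfl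

instance : NonUnitalRing (PairRing B) where
  add_assoc x y z := by ext <;> simp [add_assoc]
  zero_add x := by ext <;> simp
  add_zero x := by ext <;> simp
  add_comm x y := by ext <;> simp [add_comm]
  neg_add_cancel x := by ext <;> simp
  left_distrib x y z := by ext <;> simp [mul_add]
  right_distrib x y z := by ext <;> simp [add_mul]
  zero_mul x := by ext <;> simp
  mul_zero x := by ext <;> simp
  mul_assoc x y z := by ext <;> simp [mul_assoc]
  nsmul := nsmulRec
  zsmul := zsmulRec

end PairRing

variable [𝒮.FS]

/-- `r ↦ (ι_R r, ι_R (c r))` and similarly for `P` and `Q`. -/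
noncomputable def scaleRep (𝒮 : RSystem R P Q) [𝒮.FS] (c : F) : 𝒮.CovRep (PairRing 𝒮.Toeplitz) where
  S := AddMonoidHom.mk' (fun p => ⟨𝒮.toeplitzRep.S p, 𝒮.toeplitzRep.S (c • p)⟩)
    fun a b => by ext <;> simp
  T := AddMonoidHom.mk' (fun q => ⟨𝒮.toeplitzRep.T q, 𝒮.toeplitzRep.T (c • q)⟩)
    fun a b => by ext <;> simp
  σ :=
    { AddMonoidHom.mk' (fun r => ⟨𝒮.toeplitzRep.σ r, 𝒮.toeplitzRep.σ (c • r)⟩)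
        fun a b => by ext <;> simp with
      map_mul' := fun a b => by ext <;> simp [← smul_mul_assoc] }
  S_rsmul p r := by
    ext
    · exact 𝒮.toeplitzRep.S_rsmul p r
    · change 𝒮.toeplitzRep.S (c • (p <• r)) = 𝒮.toeplitzRep.S (c • p) * 𝒮.toeplitzRep.σ r
      rw [smul_comm, CovRep.S_rsmul]
  S_lsmul r p := by
    ext
    · exact 𝒮.toeplitzRep.S_lsmul r p
    · change 𝒮.toeplitzRep.S (c • (r • p)) = 𝒮.toeplitzRep.σ (c • r) * 𝒮.toeplitzRep.S p
      rw [← smul_assoc, CovRep.S_lsmul]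
  T_rsmul q r := by
    ext
    · exact 𝒮.toeplitzRep.T_rsmul q r
    · change 𝒮.toeplitzRep.T (c • (q <• r)) = 𝒮.toeplitzRep.T (c • q) * 𝒮.toeplitzRep.σ r
      rw [smul_comm, CovRep.T_rsmul]
  T_lsmul r q := by
    ext
    · exact 𝒮.toeplitzRep.T_lsmul r q
    · change 𝒮.toeplitzRep.T (c • (r • q)) = 𝒮.toeplitzRep.σ (c • r) * 𝒮.toeplitzRep.T q
      rw [← smul_assoc, CovRep.T_lsmul]
  cov p q := by
    ext
    · exact 𝒮.toeplitzRep.cov p q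
    · change 𝒮.toeplitzRep.σ (c • 𝒮.ψ p q) = 𝒮.toeplitzRep.S (c • p) * 𝒮.toeplitzRep.T q
      rw [← psi_smul_left, CovRep.cov]

/-- Scalar multiplication on the Toeplitz ring; it is determined by `Toeplitz.smul_mul`,
`Toeplitz.smul_R`, `Toeplitz.smul_P` and `Toeplitz.smul_Q` below. -/
noncomputable instance Toeplitz.instSMul : SMul F 𝒮.Toeplitz :=
  ⟨fun c x => (toeplitzLift (𝒮.scaleRep c) x).snd⟩

theorem Toeplitz.smul_def (c : F) (x : 𝒮.Toeplitz) :
    c • x = (toeplitzLift (𝒮.scaleRep c) x).snd := rfl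

theorem Toeplitz.smul_R (c : F) (r : R) :
    c • 𝒮.toeplitzRep.σ r = 𝒮.toeplitzRep.σ (c • r) := by
  rw [smul_def, toeplitzLift_R]; rfl

theorem Toeplitz.smul_P (c : F) (p : P) :
    c • 𝒮.toeplitzRep.S p = 𝒮.toeplitzRep.S (c • p) := by
  rw [smul_def, toeplitzLift_P]; rfl

theorem Toeplitz.smul_Q (c : F) (q : Q) :
    c • 𝒮.toeplitzRep.T q = 𝒮.toeplitzRep.T (c • q) := by
  rw [smul_def, toeplitzLift_Q]; rfl

theorem Toeplitz.scale_fst (c : F) (x : 𝒮.Toeplitz) :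
    (toeplitzLift (𝒮.scaleRep c) x).fst = x := by
  induction x using Toeplitz.induction with
  | R r => rw [toeplitzLift_R]; rfl
  | P p => rw [toeplitzLift_P]; rfl
  | Q q => rw [toeplitzLift_Q]; rfl
  | zero => rw [map_zero]; rfl
  | add x y hx hy => rw [map_add, PairRing.add_fst, hx, hy]
  | neg x hx => rw [map_neg, PairRing.neg_fst, hx]
  | mul x y hx hy => rw [map_mul, PairRing.mul_fst, hx, hy]

theorem Toeplitz.smul_mul (c : F) (x y : 𝒮.Toeplitz) : c • (x * y) = (c • x) * y := by
  rw [smul_def, smul_def, map_mul, PairRing.mul_snd, scale_fst]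

theorem Toeplitz.smul_add' (c : F) (x y : 𝒮.Toeplitz) : c • (x + y) = c • x + c • y := by
  rw [smul_def, map_add]; rfl

theorem Toeplitz.smul_zero' (c : F) : c • (0 : 𝒮.Toeplitz) = 0 := by
  rw [smul_def, map_zero]; rfl

theorem Toeplitz.smul_neg' (c : F) (x : 𝒮.Toeplitz) : c • (-x) = -(c • x) := by
  rw [smul_def, map_neg]; rfl

noncomputable instance Toeplitz.instModule : Module F 𝒮.Toeplitz where
  one_smul x := by
    induction x using Toeplitz.induction with
    | R r => rw [smul_R, one_smul]
    | P p => rw [smul_P, one_smul]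
    | Q q => rw [smul_Q, one_smul]
    | zero => rw [smul_zero']
    | add x y hx hy => rw [smul_add', hx, hy]
    | neg x hx => rw [smul_neg', hx]
    | mul x y hx hy => rw [smul_mul, hx]
  mul_smul c d x := by
    induction x using Toeplitz.induction with
    | R r => rw [smul_R, smul_R, smul_R, mul_smul]
    | P p => rw [smul_P, smul_P, smul_P, mul_smul]
    | Q q => rw [smul_Q, smul_Q, smul_Q, mul_smul]
    | zero => rw [smul_zero', smul_zero', smul_zero']
    | add x y hx hy => rw [smul_add', smul_add', smul_add', hx, hy]
    | neg x hx => rw [smul_neg', smul_neg', smul_neg', hx]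
    | mul x y hx hy => rw [smul_mul, smul_mul, smul_mul, hx]
  smul_zero := smul_zero'
  smul_add := smul_add'
  add_smul c d x := by
    induction x using Toeplitz.induction with
    | R r => rw [smul_R, smul_R, smul_R, add_smul, map_add]
    | P p => rw [smul_P, smul_P, smul_P, add_smul, map_add]
    | Q q => rw [smul_Q, smul_Q, smul_Q, add_smul, map_add]
    | zero => rw [smul_zero', smul_zero', smul_zero', add_zero]
    | add x y hx hy => rw [smul_add', smul_add', smul_add', hx, hy]; abel
    | neg x hx => rw [smul_neg', smul_neg', smul_neg', hx]; abel
    | mul x y hx hy => rw [smul_mul, smul_mul, smul_mul, hx, add_mul]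
  zero_smul x := by
    induction x using Toeplitz.induction with
    | R r => rw [smul_R, zero_smul, map_zero]
    | P p => rw [smul_P, zero_smul, map_zero]
    | Q q => rw [smul_Q, zero_smul, map_zero]
    | zero => rw [smul_zero']
    | add x y hx hy => rw [smul_add', hx, hy, add_zero]
    | neg x hx => rw [smul_neg', hx, neg_zero]
    | mul x y hx hy => rw [smul_mul, hx, zero_mul]

instance Toeplitz.instIsScalarTower : IsScalarTower F 𝒮.Toeplitz 𝒮.Toeplitz :=
  ⟨fun c x y => (smul_mul c x y).symm⟩

/-- `x (c y) = (c x) y` holds for all `y` if it holds for the generators `y`. -/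
theorem Toeplitz.mul_smul_of_gen (c : F) (x : 𝒮.Toeplitz)
    (hR : ∀ r, x * c • 𝒮.toeplitzRep.σ r = (c • x) * 𝒮.toeplitzRep.σ r)
    (hP : ∀ p, x * c • 𝒮.toeplitzRep.S p = (c • x) * 𝒮.toeplitzRep.S p)
    (hQ : ∀ q, x * c • 𝒮.toeplitzRep.T q = (c • x) * 𝒮.toeplitzRep.T q)
    (y : 𝒮.Toeplitz) : x * c • y = (c • x) * y := by
  induction y using Toeplitz.induction with
  | R r => exact hR r
  | P p => exact hP p
  | Q q => exact hQ q
  | zero => rw [smul_zero, mul_zero, mul_zero]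
  | add y z hy hz => rw [smul_add, mul_add, mul_add, hy, hz]
  | neg y hy => rw [smul_neg, mul_neg, mul_neg, hy]
  | mul y z hy hz => rw [smul_mul, ← mul_assoc, hy, mul_assoc]

theorem Toeplitz.mul_smul_R (c : F) (r : R) (y : 𝒮.Toeplitz) :
    𝒮.toeplitzRep.σ r * c • y = (c • 𝒮.toeplitzRep.σ r) * y := by
  refine mul_smul_of_gen c _ (fun s => ?_) (fun p => ?_) (fun q => ?_) y
  · rw [smul_R, smul_R, ← map_mul, ← map_mul, mul_smul_comm, smul_mul_assoc]
  · rw [smul_R, smul_P, ← CovRep.S_lsmul, ← CovRep.S_lsmul, smul_assoc, smul_comm c r p]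
  · rw [smul_R, smul_Q, ← CovRep.T_lsmul, ← CovRep.T_lsmul, smul_assoc, smul_comm c r q]

theorem Toeplitz.mul_smul_Q (c : F) (q : Q) (y : 𝒮.Toeplitz) :
    𝒮.toeplitzRep.T q * c • y = (c • 𝒮.toeplitzRep.T q) * y := by
  obtain ⟨Θ, hΘ, -, -, h, -⟩ := FS.exists_finRank (𝒮 := 𝒮) {q} ∅
  rw [← h q (Finset.mem_singleton_self q)]
  clear h
  induction hΘ using AddSubgroup.closure_induction with
  | mem x hx =>
    obtain ⟨e, f, rfl⟩ := hx
    change 𝒮.toeplitzRep.T (e <• 𝒮.ψ f q) * c • y = (c • 𝒮.toeplitzRep.T (e <• 𝒮.ψ f q)) * y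
    rw [CovRep.T_rsmul, mul_assoc, mul_smul_R, ← mul_assoc, smul_R, ← CovRep.T_rsmul,
      ← CovRep.T_rsmul, smul_Q, MulOpposite.op_smul, smul_assoc]
  | zero => simp
  | add x z _ _ hx hz => simp only [AddMonoidHom.add_apply, map_add, add_mul, smul_add, hx, hz]
  | neg x _ hx => simp only [AddMonoidHom.neg_apply, map_neg, neg_mul, smul_neg, hx]

theorem Toeplitz.mul_smul_P (c : F) (p : P) (y : 𝒮.Toeplitz) :
    𝒮.toeplitzRep.S p * c • y = (c • 𝒮.toeplitzRep.S p) * y := by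
  have hR : ∀ r, 𝒮.toeplitzRep.S p * c • 𝒮.toeplitzRep.σ r
      = (c • 𝒮.toeplitzRep.S p) * 𝒮.toeplitzRep.σ r := fun r => by
    rw [smul_R, smul_P, ← CovRep.S_rsmul, ← CovRep.S_rsmul, MulOpposite.op_smul, smul_assoc,
      smul_comm]
  refine mul_smul_of_gen c _ hR (fun p' => ?_) (fun q => ?_) y
  · obtain ⟨-, -, Ω, hΩ, -, h⟩ := FS.exists_finRank (𝒮 := 𝒮) ∅ {p'}
    rw [← h p' (Finset.mem_singleton_self p')]
    clear h
    induction hΩ using AddSubgroup.closure_induction with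
    | mem x hx =>
      obtain ⟨e, f, rfl⟩ := hx
      change 𝒮.toeplitzRep.S p * c • 𝒮.toeplitzRep.S (𝒮.ψ p' f • e)
        = (c • 𝒮.toeplitzRep.S p) * 𝒮.toeplitzRep.S (𝒮.ψ p' f • e)
      rw [CovRep.S_lsmul, smul_mul, ← mul_assoc, hR, mul_assoc]
    | zero => simp
    | add x z _ _ hx hz => simp only [AddMonoidHom.add_apply, map_add, mul_add, smul_add, hx, hz]
    | neg x _ hx => simp only [AddMonoidHom.neg_apply, map_neg, mul_neg, smul_neg, hx]
  · rw [smul_P, smul_Q, ← CovRep.cov, ← CovRep.cov, psi_smul_left, psi_smul_right]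

theorem Toeplitz.mul_smul' (c : F) (x y : 𝒮.Toeplitz) : x * c • y = (c • x) * y := by
  induction x using Toeplitz.induction generalizing y with
  | R r => exact mul_smul_R c r y
  | P p => exact mul_smul_P c p y
  | Q q => exact mul_smul_Q c q y
  | zero => rw [smul_zero, zero_mul, zero_mul]
  | add x z hx hz => rw [smul_add, add_mul, add_mul, hx, hz]
  | neg x hx => rw [smul_neg, neg_mul, neg_mul, hx]
  | mul x z hx hz => rw [mul_assoc, hz, ← mul_assoc, hx, smul_mul]

instance Toeplitz.instSMulCommClass : SMulCommClass F 𝒮.Toeplitz 𝒮.Toeplitz :=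
  ⟨fun c x y => (smul_mul c x y).trans (mul_smul' c x y).symm⟩

/-! #### The `F`-algebra structure of the relative Cuntz–Pimsner rings -/

theorem smul_theta (c : F) (q : Q) (p : P) : c • 𝒮.theta q p = 𝒮.theta (c • q) p := by
  ext x
  change c • (q <• 𝒮.ψ p x) = (c • q) <• 𝒮.ψ p x
  rw [smul_comm]

theorem smul_Delta (c : F) (x : R) : 𝒮.Delta (c • x) = c • 𝒮.Delta x := by
  ext q
  exact smul_assoc c x q

theorem pi_smul (c : F) (Θ : Q →+ Q) (hΘ : Θ ∈ 𝒮.finRank) :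
    ∃ h : c • Θ ∈ 𝒮.finRank,
      𝒮.toeplitzRep.pi ⟨c • Θ, h⟩ = c • 𝒮.toeplitzRep.pi ⟨Θ, hΘ⟩ := by
  induction hΘ using AddSubgroup.closure_induction with
  | mem x hx =>
    obtain ⟨q, p, rfl⟩ := hx
    simp only [smul_theta]
    exact ⟨CovRep.theta_mem _ _ _, by
      rw [CovRep.pi_theta, CovRep.pi_theta, ← Toeplitz.smul_Q, smul_mul_assoc]⟩
  | zero =>
    have h : c • (0 : Q →+ Q) = 0 := smul_zero c
    simp only [h]
    exact ⟨zero_mem _, by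
      rw [show (⟨0, zero_mem _⟩ : 𝒮.finRank) = 0 from rfl, map_zero, smul_zero]⟩
  | add x y hx' hy' hx hy =>
    obtain ⟨hx, ex⟩ := hx
    obtain ⟨hy, ey⟩ := hy
    simp only [smul_add]
    refine ⟨add_mem hx hy, ?_⟩
    rw [show (⟨c • x + c • y, add_mem hx hy⟩ : 𝒮.finRank) = ⟨c • x, hx⟩ + ⟨c • y, hy⟩ from rfl,
      show (⟨x + y, add_mem hx' hy'⟩ : 𝒮.finRank) = ⟨x, hx'⟩ + ⟨y, hy'⟩ from rfl,
      map_add, map_add, ex, ey, smul_add]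
  | neg x hx' hx =>
    obtain ⟨hx, ex⟩ := hx
    simp only [smul_neg]
    refine ⟨neg_mem hx, ?_⟩
    rw [show (⟨-(c • x), neg_mem hx⟩ : 𝒮.finRank) = -⟨c • x, hx⟩ from rfl,
      show (⟨-x, neg_mem hx'⟩ : 𝒮.finRank) = -⟨x, hx'⟩ from rfl,
      map_neg, map_neg, ex, smul_neg]

theorem toeplitzIdeal_smul_mem (J : TwoSidedIdeal R) [IsSMulStable F J] (c : F)
    {y : 𝒮.Toeplitz} (hy : y ∈ 𝒮.toeplitzIdeal J) : c • y ∈ 𝒮.toeplitzIdeal J := by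
  unfold toeplitzIdeal at hy
  induction hy using TwoSidedIdeal.span_induction with
  | mem y hy =>
    obtain ⟨x, hx, h, rfl⟩ := hy
    obtain ⟨h', e⟩ := pi_smul c _ h
    refine TwoSidedIdeal.subset_span ⟨c • x, IsSMulStable.smul_mem c x hx, ?_⟩
    simp only [smul_Delta]
    exact ⟨h', by rw [e, smul_sub, Toeplitz.smul_R]⟩
  | zero => rw [smul_zero]; exact zero_mem _
  | add x y _ _ hx hy => rw [smul_add]; exact add_mem hx hy
  | neg x _ hx => rw [smul_neg]; exact neg_mem hx
  | left_absorb a x hx' hx =>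
    rw [← mul_smul_comm]; exact TwoSidedIdeal.mul_mem_left _ _ _ hx
  | right_absorb b x hx' hx =>
    rw [← smul_mul_assoc]; exact TwoSidedIdeal.mul_mem_right _ _ _ hx

theorem rho_surjective (J : TwoSidedIdeal R) : Function.Surjective (𝒮.rho J) :=
  idealMk_surjective _

/-- Scalar multiplication on `𝒪_{(P,Q,ψ)}(J)`: the one for which `ρ_J` is `F`-linear. -/
noncomputable instance RelCP.instSMul (J : TwoSidedIdeal R) [IsSMulStable F J] :
    SMul F (𝒮.RelCP J) :=
  ⟨fun c x => Quotient.liftOn' x (fun y => 𝒮.rho J (c • y)) fun a b hab => by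
    have h := toeplitzIdeal_smul_mem J c (((𝒮.toeplitzIdeal J).rel_iff a b).1 hab)
    have h' : 𝒮.rho J (c • (a - b)) = 0 := (idealMk_eq_zero _).2 h
    rwa [smul_sub, map_sub, sub_eq_zero] at h'⟩

theorem rho_smul (J : TwoSidedIdeal R) [IsSMulStable F J] (c : F) (x : 𝒮.Toeplitz) :
    𝒮.rho J (c • x) = c • 𝒮.rho J x := rfl

noncomputable instance RelCP.instModule (J : TwoSidedIdeal R) [IsSMulStable F J] :
    Module F (𝒮.RelCP J) :=
  Function.Surjective.module F (𝒮.rho J : 𝒮.Toeplitz →+ 𝒮.RelCP J) (rho_surjective J)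
    (rho_smul J)

instance RelCP.instIsScalarTower (J : TwoSidedIdeal R) [IsSMulStable F J] :
    IsScalarTower F (𝒮.RelCP J) (𝒮.RelCP J) :=
  ⟨fun c x y => by
    obtain ⟨x, rfl⟩ := rho_surjective J x
    obtain ⟨y, rfl⟩ := rho_surjective J y
    change (c • 𝒮.rho J x) * 𝒮.rho J y = c • (𝒮.rho J x * 𝒮.rho J y)
    rw [← map_mul, ← rho_smul, ← rho_smul, ← map_mul, smul_mul_assoc]⟩

instance RelCP.instSMulCommClass (J : TwoSidedIdeal R) [IsSMulStable F J] :
    SMulCommClass F (𝒮.RelCP J) (𝒮.RelCP J) :=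
  ⟨fun c x y => by
    obtain ⟨x, rfl⟩ := rho_surjective J x
    obtain ⟨y, rfl⟩ := rho_surjective J y
    change c • (𝒮.rho J x * 𝒮.rho J y) = 𝒮.rho J x * (c • 𝒮.rho J y)
    rw [← map_mul, ← rho_smul, ← rho_smul, ← map_mul, mul_smul_comm]⟩

theorem iotaR_smul (J : TwoSidedIdeal R) [IsSMulStable F J] (c : F) (r : R) :
    𝒮.iotaR J (c • r) = c • 𝒮.iotaR J r := by
  rw [iotaR, iotaR, ← rho_smul, Toeplitz.smul_R]

theorem iotaP_smul (J : TwoSidedIdeal R) [IsSMulStable F J] (c : F) (p : P) :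
    𝒮.iotaP J (c • p) = c • 𝒮.iotaP J p := by
  rw [iotaP, iotaP, ← rho_smul, Toeplitz.smul_P]

theorem iotaQ_smul (J : TwoSidedIdeal R) [IsSMulStable F J] (c : F) (q : Q) :
    𝒮.iotaQ J (c • q) = c • 𝒮.iotaQ J q := by
  rw [iotaQ, iotaQ, ← rho_smul, Toeplitz.smul_Q]

/-- The uniquely maximal faithful `ψ`-compatible ideal is an `F`-subspace. -/
instance cpIdeal_isSMulStable (h : ∃ J, 𝒮.IsUniquelyMaximal J) :
    IsSMulStable F (𝒮.cpIdeal h) where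
  smul_mem c x hx := by
    obtain ⟨⟨hc, hf⟩, hmax⟩ : 𝒮.IsUniquelyMaximal (𝒮.cpIdeal h) := h.choose_spec
    rcases eq_or_ne c 0 with rfl | hc0
    · rw [zero_smul]; exact zero_mem _
    let J' : TwoSidedIdeal R := .mk' {y | c⁻¹ • y ∈ 𝒮.cpIdeal h}
      (by simp)
      (fun {x y} hx hy => by
        rw [Set.mem_ofPred_eq, smul_add]; exact add_mem hx hy)
      (fun {x} hx => by
        rw [Set.mem_ofPred_eq, smul_neg]; exact neg_mem hx)
      (fun {x y} hy => by
        rw [Set.mem_ofPred_eq, ← mul_smul_comm]; exact TwoSidedIdeal.mul_mem_left _ _ _ hy)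
      (fun {x y} hx => by
        rw [Set.mem_ofPred_eq, ← smul_mul_assoc]; exact TwoSidedIdeal.mul_mem_right _ _ _ hx)
    have hJ' : ∀ y, y ∈ J' ↔ c⁻¹ • y ∈ 𝒮.cpIdeal h := fun y => TwoSidedIdeal.mem_mk' _ _ _ _ _ _ y
    refine hmax J' ⟨fun y hy => ?_, fun y hy h0 => ?_⟩ ((hJ' _).2 ?_)
    · obtain ⟨h', -⟩ := pi_smul c _ (hc _ ((hJ' y).1 hy))
      rwa [← smul_Delta, smul_inv_smul₀ hc0] at h'
    · have h1 := hf _ ((hJ' y).1 hy) (by rw [smul_Delta, h0, smul_zero])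
      rwa [smul_eq_zero_iff_right (inv_ne_zero hc0)] at h1
    · rwa [inv_smul_smul₀ hc0]

/-! #### The gauge action -/

/-- The covariant representation `(t ι_P, t⁻¹ ι_Q, ι_R)` on the Toeplitz ring. -/
noncomputable def gaugeRep (𝒮 : RSystem R P Q) [𝒮.FS] (t : Fˣ) : 𝒮.CovRep 𝒮.Toeplitz where
  S := AddMonoidHom.mk' (fun p => (t : F) • 𝒮.toeplitzRep.S p) fun a b => by
    rw [map_add, smul_add]
  T := AddMonoidHom.mk' (fun q => ((t⁻¹ : Fˣ) : F) • 𝒮.toeplitzRep.T q) fun a b => by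
    rw [map_add, smul_add]
  σ := 𝒮.toeplitzRep.σ
  S_rsmul p r := by
    change (t : F) • 𝒮.toeplitzRep.S (p <• r) = ((t : F) • 𝒮.toeplitzRep.S p) * _
    rw [CovRep.S_rsmul, smul_mul_assoc]
  S_lsmul r p := by
    change (t : F) • 𝒮.toeplitzRep.S (r • p) = _ * ((t : F) • 𝒮.toeplitzRep.S p)
    rw [CovRep.S_lsmul, mul_smul_comm]
  T_rsmul q r := by
    change ((t⁻¹ : Fˣ) : F) • 𝒮.toeplitzRep.T (q <• r) = (((t⁻¹ : Fˣ) : F) • 𝒮.toeplitzRep.T q) * _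
    rw [CovRep.T_rsmul, smul_mul_assoc]
  T_lsmul r q := by
    change ((t⁻¹ : Fˣ) : F) • 𝒮.toeplitzRep.T (r • q) = _ * (((t⁻¹ : Fˣ) : F) • 𝒮.toeplitzRep.T q)
    rw [CovRep.T_lsmul, mul_smul_comm]
  cov p q := by
    change _ = ((t : F) • 𝒮.toeplitzRep.S p) * (((t⁻¹ : Fˣ) : F) • 𝒮.toeplitzRep.T q)
    rw [mul_smul_comm, smul_mul_assoc, smul_smul, Units.inv_mul, one_smul, CovRep.cov]

/-- The gauge endomorphism of the Toeplitz ring. -/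
noncomputable def gaugeToeplitz (𝒮 : RSystem R P Q) [𝒮.FS] (t : Fˣ) : 𝒮.Toeplitz →ₙ+* 𝒮.Toeplitz :=
  toeplitzLift (𝒮.gaugeRep t)

theorem gaugeToeplitz_R (t : Fˣ) (r : R) :
    𝒮.gaugeToeplitz t (𝒮.toeplitzRep.σ r) = 𝒮.toeplitzRep.σ r := toeplitzLift_R _ _

theorem gaugeToeplitz_P (t : Fˣ) (p : P) :
    𝒮.gaugeToeplitz t (𝒮.toeplitzRep.S p) = (t : F) • 𝒮.toeplitzRep.S p := toeplitzLift_P _ _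

theorem gaugeToeplitz_Q (t : Fˣ) (q : Q) :
    𝒮.gaugeToeplitz t (𝒮.toeplitzRep.T q) = ((t⁻¹ : Fˣ) : F) • 𝒮.toeplitzRep.T q :=
  toeplitzLift_Q _ _

theorem gaugeToeplitz_smul (t : Fˣ) (c : F) (x : 𝒮.Toeplitz) :
    𝒮.gaugeToeplitz t (c • x) = c • 𝒮.gaugeToeplitz t x := by
  induction x using Toeplitz.induction with
  | R r => rw [Toeplitz.smul_R, gaugeToeplitz_R, gaugeToeplitz_R, Toeplitz.smul_R]
  | P p => rw [Toeplitz.smul_P, gaugeToeplitz_P, gaugeToeplitz_P, ← Toeplitz.smul_P, smul_comm]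
  | Q q => rw [Toeplitz.smul_Q, gaugeToeplitz_Q, gaugeToeplitz_Q, ← Toeplitz.smul_Q, smul_comm]
  | zero => rw [smul_zero, map_zero, smul_zero]
  | add x y hx hy => rw [smul_add, map_add, hx, hy, map_add, smul_add]
  | neg x hx => rw [smul_neg, map_neg, hx, map_neg, smul_neg]
  | mul x y hx hy => rw [Toeplitz.smul_mul, map_mul, hx, map_mul, Toeplitz.smul_mul]

theorem gaugeToeplitz_mul (s t : Fˣ) (x : 𝒮.Toeplitz) :
    𝒮.gaugeToeplitz (s * t) x = 𝒮.gaugeToeplitz s (𝒮.gaugeToeplitz t x) := by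
  induction x using Toeplitz.induction with
  | R r => rw [gaugeToeplitz_R, gaugeToeplitz_R, gaugeToeplitz_R]
  | P p =>
    rw [gaugeToeplitz_P, gaugeToeplitz_P, gaugeToeplitz_smul, gaugeToeplitz_P, smul_smul,
      Units.val_mul, mul_comm]
  | Q q =>
    rw [gaugeToeplitz_Q, gaugeToeplitz_Q, gaugeToeplitz_smul, gaugeToeplitz_Q, smul_smul,
      mul_inv_rev, Units.val_mul]
  | zero => simp only [map_zero]
  | add x y hx hy => simp only [map_add, hx, hy]
  | neg x hx => simp only [map_neg, hx]
  | mul x y hx hy => simp only [map_mul, hx, hy]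

theorem gaugeToeplitz_one (x : 𝒮.Toeplitz) : 𝒮.gaugeToeplitz (1 : Fˣ) x = x := by
  induction x using Toeplitz.induction with
  | R r => rw [gaugeToeplitz_R]
  | P p => rw [gaugeToeplitz_P, Units.val_one, one_smul]
  | Q q => rw [gaugeToeplitz_Q, inv_one, Units.val_one, one_smul]
  | zero => rw [map_zero]
  | add x y hx hy => rw [map_add, hx, hy]
  | neg x hx => rw [map_neg, hx]
  | mul x y hx hy => rw [map_mul, hx, hy]

theorem gaugeToeplitz_pi (t : Fˣ) (Θ : Q →+ Q) (hΘ : Θ ∈ 𝒮.finRank) :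
    𝒮.gaugeToeplitz t (𝒮.toeplitzRep.pi ⟨Θ, hΘ⟩) = 𝒮.toeplitzRep.pi ⟨Θ, hΘ⟩ := by
  induction hΘ using AddSubgroup.closure_induction with
  | mem x hx =>
    obtain ⟨q, p, rfl⟩ := hx
    rw [CovRep.pi_theta, map_mul, gaugeToeplitz_Q, gaugeToeplitz_P, mul_smul_comm,
      smul_mul_assoc, smul_smul, Units.mul_inv, one_smul]
  | zero =>
    rw [show (⟨0, zero_mem _⟩ : 𝒮.finRank) = 0 from rfl, map_zero, map_zero]
  | add x y hx' hy' hx hy =>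
    rw [show (⟨x + y, add_mem hx' hy'⟩ : 𝒮.finRank) = ⟨x, hx'⟩ + ⟨y, hy'⟩ from rfl,
      map_add, map_add, hx, hy]
  | neg x hx' hx =>
    rw [show (⟨-x, neg_mem hx'⟩ : 𝒮.finRank) = -⟨x, hx'⟩ from rfl, map_neg, map_neg, hx]

theorem gaugeToeplitz_mem (J : TwoSidedIdeal R) (t : Fˣ) (y : 𝒮.Toeplitz)
    (hy : y ∈ 𝒮.toeplitzIdeal J) : 𝒮.gaugeToeplitz t y ∈ 𝒮.toeplitzIdeal J := by
  unfold toeplitzIdeal at hy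
  induction hy using TwoSidedIdeal.span_induction with
  | mem y hy =>
    obtain ⟨x, hx, h, rfl⟩ := hy
    rw [map_sub, gaugeToeplitz_R, gaugeToeplitz_pi]
    exact TwoSidedIdeal.subset_span ⟨x, hx, h, rfl⟩
  | zero => rw [map_zero]; exact zero_mem _
  | add x y _ _ hx hy => rw [map_add]; exact add_mem hx hy
  | neg x _ hx => rw [map_neg]; exact neg_mem hx
  | left_absorb a x _ hx => rw [map_mul]; exact TwoSidedIdeal.mul_mem_left _ _ _ hx
  | right_absorb b x _ hx => rw [map_mul]; exact TwoSidedIdeal.mul_mem_right _ _ _ hx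

/-- The gauge endomorphism of `𝒪_{(P,Q,ψ)}(J)`. -/
noncomputable def gaugeHom (𝒮 : RSystem R P Q) [𝒮.FS] (J : TwoSidedIdeal R) (t : Fˣ) :
    𝒮.RelCP J →ₙ+* 𝒮.RelCP J :=
  idealLift (𝒮.toeplitzIdeal J) ((𝒮.rho J).comp (𝒮.gaugeToeplitz t)) fun y hy =>
    (idealMk_eq_zero _).2 (gaugeToeplitz_mem J t y hy)

theorem gaugeHom_rho (J : TwoSidedIdeal R) (t : Fˣ) (x : 𝒮.Toeplitz) :
    𝒮.gaugeHom J t (𝒮.rho J x) = 𝒮.rho J (𝒮.gaugeToeplitz t x) := rfl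

theorem gaugeHom_mul (J : TwoSidedIdeal R) (s t : Fˣ) (x : 𝒮.RelCP J) :
    𝒮.gaugeHom J (s * t) x = 𝒮.gaugeHom J s (𝒮.gaugeHom J t x) := by
  obtain ⟨x, rfl⟩ := rho_surjective J x
  rw [gaugeHom_rho, gaugeHom_rho, gaugeHom_rho, gaugeToeplitz_mul]

theorem gaugeHom_one (J : TwoSidedIdeal R) (x : 𝒮.RelCP J) :
    𝒮.gaugeHom J (1 : Fˣ) x = x := by
  obtain ⟨x, rfl⟩ := rho_surjective J x
  rw [gaugeHom_rho, gaugeToeplitz_one]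

/-- The gauge action `τ^J : Fˣ → Aut_F(𝒪_{(P,Q,ψ)}(J))`; see `gauge_R`, `gauge_P`, `gauge_Q`. -/
noncomputable def gauge (F : Type*) {R P Q : Type*} [Field F] [NonUnitalRing R] [AddCommGroup P]
    [AddCommGroup Q] [NUBimodule R P] [NUBimodule R Q]
    [Module F R] [IsScalarTower F R R] [SMulCommClass F R R]
    [Module F P] [IsScalarTower F R P] [SMulCommClass F R P]
    [IsScalarTower F Rᵐᵒᵖ P] [SMulCommClass F Rᵐᵒᵖ P]
    [Module F Q] [IsScalarTower F R Q] [SMulCommClass F R Q]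
    [IsScalarTower F Rᵐᵒᵖ Q] [SMulCommClass F Rᵐᵒᵖ Q]
    (𝒮 : RSystem R P Q) [𝒮.FS] (J : TwoSidedIdeal R) [IsSMulStable F J] :
    Fˣ →* AlgAut F (𝒮.RelCP J) where
  toFun t :=
    ⟨{ 𝒮.gaugeHom J t with
        invFun := 𝒮.gaugeHom J t⁻¹
        left_inv := fun x => by
          change 𝒮.gaugeHom J t⁻¹ (𝒮.gaugeHom J t x) = x
          rw [← gaugeHom_mul, inv_mul_cancel, gaugeHom_one]
        right_inv := fun x => by
          change 𝒮.gaugeHom J t (𝒮.gaugeHom J t⁻¹ x) = x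
          rw [← gaugeHom_mul, mul_inv_cancel, gaugeHom_one] },
      fun c x => by
        change 𝒮.gaugeHom J t (c • x) = c • 𝒮.gaugeHom J t x
        obtain ⟨x, rfl⟩ := rho_surjective J x
        rw [← rho_smul, gaugeHom_rho, gaugeToeplitz_smul, rho_smul, gaugeHom_rho]⟩
  map_one' := Subtype.ext (RingEquiv.ext fun x => gaugeHom_one J x)
  map_mul' s t := Subtype.ext (RingEquiv.ext fun x => gaugeHom_mul J s t x)

theorem gauge_R (J : TwoSidedIdeal R) [IsSMulStable F J] (t : Fˣ) (r : R) :
    (𝒮.gauge F J t).1 (𝒮.iotaR J r) = 𝒮.iotaR J r :=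
  congrArg (𝒮.rho J) (gaugeToeplitz_R t r)

theorem gauge_P (J : TwoSidedIdeal R) [IsSMulStable F J] (t : Fˣ) (p : P) :
    (𝒮.gauge F J t).1 (𝒮.iotaP J p) = (t : F) • 𝒮.iotaP J p :=
  congrArg (𝒮.rho J) (gaugeToeplitz_P t p)

theorem gauge_Q (J : TwoSidedIdeal R) [IsSMulStable F J] (t : Fˣ) (q : Q) :
    (𝒮.gauge F J t).1 (𝒮.iotaQ J q) = ((t⁻¹ : Fˣ) : F) • 𝒮.iotaQ J q :=
  congrArg (𝒮.rho J) (gaugeToeplitz_Q t q)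

end Algebra
end RSystem

namespace RSystem

variable {R P Q : Type*} [NonUnitalRing R] [AddCommGroup P] [AddCommGroup Q]
  [NUBimodule R P] [NUBimodule R Q] {𝒮 : RSystem R P Q}

/-! The kernel of `φ` is stable under the gauge action. An element of degree `n` (number of factors
from `T(Q)` minus number from `S(P)`) is scaled by `t^(-n)`, so applying `φ` to the translates of a
kernel element yields a Laurent polynomial in `t` that vanishes on all of `Fˣ`. As `F` is infinite,
its coefficients vanish: the homogeneous components lie in the kernel (`apply_homogeneous_eq_zero`).
It remains to show that `φ` is injective on each degree.

Condition (FS) turns elements of `π(𝓕_P(Q))` into local units, so an element of positive degree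
killed by all `S(p)` from the left is zero, and dually for negative degree and `T(q)` from the
right. This reduces every degree to degree 0. There, compressing by `x ↦ S(p) x T(q)` lowers the
filtration `core n`, and an induction shows that a kernel element has the form `σ(r) - π(Δ(r))` with
`Δ(r) ∈ 𝓕_P(Q)` (`eq_zero_of_mem_core`).

Maximality of `J` disposes of such an element. The `r` with `φ(σ(r)) = φ(π(Δ(r)))` form an ideal
containing `J`; it is compatible by definition, faithful because `φ` is injective on `ι_R(R)`, and
an `F`-subspace. Hence it equals `J`, and `σ(r) = π(Δ(r))` already holds in `𝒪(J)`. -/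

theorem finRank_induction {motive : 𝒮.finRank → Prop}
    (theta : ∀ q p, motive ⟨𝒮.theta q p, CovRep.theta_mem 𝒮 q p⟩) (zero : motive 0)
    (add : ∀ x y, motive x → motive y → motive (x + y)) (neg : ∀ x, motive x → motive (-x))
    (Θ : 𝒮.finRank) : motive Θ := by
  obtain ⟨Θ, hΘ⟩ := Θ
  induction hΘ using AddSubgroup.closure_induction with
  | mem x hx =>
    obtain ⟨q, p, rfl⟩ := hx
    exact theta q p
  | zero => exact zero
  | add x y hx hy ihx ihy => exact add ⟨x, hx⟩ ⟨y, hy⟩ ihx ihy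
  | neg x hx ihx => exact neg ⟨x, hx⟩ ihx

/-! ### Left multiplications and rank one maps on `Q`. -/

theorem Delta_comp_theta (r : R) (q : Q) (p : P) :
    (𝒮.Delta r).comp (𝒮.theta q p) = 𝒮.theta (r • q) p := by
  ext x
  exact (NUBimodule.lsmul_rsmul r (𝒮.ψ p x) q).symm

theorem theta_comp_Delta (r : R) (q : Q) (p : P) :
    (𝒮.theta q p).comp (𝒮.Delta r) = 𝒮.theta q (p <• r) := by
  ext x
  change q <• 𝒮.ψ p (r • x) = q <• 𝒮.ψ (p <• r) x
  rw [𝒮.balanced]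

theorem Delta_mul (r s : R) : 𝒮.Delta (r * s) = (𝒮.Delta r).comp (𝒮.Delta s) := by
  ext x
  exact NUBimodule.mul_lsmul r s x

theorem Delta_add (r s : R) : 𝒮.Delta (r + s) = 𝒮.Delta r + 𝒮.Delta s := by
  ext x
  exact NUBimodule.add_lsmul r s x

theorem Delta_zero : 𝒮.Delta 0 = 0 := by
  have h := 𝒮.Delta_add (0 : R) 0
  rw [add_zero] at h
  exact left_eq_add.1 h

theorem Delta_neg (r : R) : 𝒮.Delta (-r) = -𝒮.Delta r := by
  rw [eq_neg_iff_add_eq_zero, ← Delta_add, neg_add_cancel, Delta_zero]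

/-- An element of `Q` that is orthogonal to `P` vanishes. -/
theorem eq_zero_of_psi_eq_zero [h𝒮 : 𝒮.FS] {q : Q} (h : ∀ p, 𝒮.ψ p q = 0) : q = 0 := by
  -- (FS) writes `q` as `Θ q`, a signed sum of terms `e ψ(f ⊗ q)`, each of which vanishes.
  obtain ⟨Θ, hΘ, -, -, hq, -⟩ := h𝒮.exists_finRank {q} ∅
  rw [← hq q (Finset.mem_singleton_self q)]
  clear hq
  induction hΘ using AddSubgroup.closure_induction with
  | mem x hx =>
    obtain ⟨e, f, rfl⟩ := hx
    -- The bimodule axioms contain no zero law, so `e 0 = 0` is read off from the additivity of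
    -- `θ_{e,f}`.
    have h0 := (𝒮.theta e f).map_zero
    change e <• 𝒮.ψ f 0 = 0 at h0
    change e <• 𝒮.ψ f q = 0
    rwa [h f, ← map_zero (𝒮.ψ f)]
  | zero => rfl
  | add x y _ _ hx hy => rw [AddMonoidHom.add_apply, hx, hy, add_zero]
  | neg x _ hx => rw [AddMonoidHom.neg_apply, hx, neg_zero]

/-! ### The map `π` of a covariant representation and its multiplication rules. -/

namespace CovRep

variable {B B' : Type*} [NonUnitalRing B] [NonUnitalRing B'] (c : 𝒮.CovRep B)

/-- The composite of a covariant representation with a ring homomorphism. -/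
def map (f : B →ₙ+* B') : 𝒮.CovRep B' where
  S := (f : B →+ B').comp c.S
  T := (f : B →+ B').comp c.T
  σ := f.comp c.σ
  S_rsmul p r := (congrArg f (c.S_rsmul p r)).trans (map_mul f _ _)
  S_lsmul r p := (congrArg f (c.S_lsmul r p)).trans (map_mul f _ _)
  T_rsmul q r := (congrArg f (c.T_rsmul q r)).trans (map_mul f _ _)
  T_lsmul r q := (congrArg f (c.T_lsmul r q)).trans (map_mul f _ _)
  cov p q := (congrArg f (c.cov p q)).trans (map_mul f _ _)

/-- Both sides are additive in `Θ` and agree on rank one maps. This carries `π` along the quotient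
map `ρ_J` and along `φ`. -/
theorem map_pi [𝒮.FS] (f : B →ₙ+* B') (Θ : 𝒮.finRank) : (c.map f).pi Θ = f (c.pi Θ) := by
  induction Θ using finRank_induction with
  | theta q p =>
    rw [pi_theta, pi_theta, map_mul]
    rfl
  | zero => simp only [map_zero]
  | add x y hx hy => simp only [map_add, hx, hy]
  | neg x hx => simp only [map_neg, hx]

/-- For rank one, `T(e) S(f) T(q) = T(e) σ(ψ(f ⊗ q)) = T(e ψ(f ⊗ q))`. Through this identity an
operator fixing some `q` becomes a left unit for `T(q)`. -/
theorem pi_mul_T [𝒮.FS] (Θ : 𝒮.finRank) (q : Q) : c.pi Θ * c.T q = c.T (Θ.1 q) := by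
  induction Θ using finRank_induction with
  | theta e f =>
    rw [pi_theta, mul_assoc, ← c.cov, ← c.T_rsmul]
    rfl
  | zero =>
    rw [map_zero, zero_mul]
    exact (map_zero c.T).symm
  | add x y hx hy =>
    rw [map_add, add_mul, hx, hy, ← map_add]
    rfl
  | neg x hx =>
    rw [map_neg, neg_mul, hx, ← map_neg]
    rfl

theorem sigma_mul_pi [𝒮.FS] (r : R) (Θ : 𝒮.finRank) :
    ∃ h : (𝒮.Delta r).comp Θ.1 ∈ 𝒮.finRank, c.pi ⟨_, h⟩ = c.σ r * c.pi Θ := by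
  -- Bundling the membership proof into `Θ'` lets the induction add and negate inside the subgroup,
  -- where `π` is additive.
  suffices H : ∃ Θ' : 𝒮.finRank, Θ'.1 = (𝒮.Delta r).comp Θ.1 ∧ c.pi Θ' = c.σ r * c.pi Θ by
    obtain ⟨⟨Θ', h'⟩, h1, h2⟩ := H
    subst h1
    exact ⟨h', h2⟩
  induction Θ using finRank_induction with
  | theta e f =>
    refine ⟨⟨_, theta_mem 𝒮 (r • e) f⟩, (Delta_comp_theta r e f).symm, ?_⟩
    rw [pi_theta, pi_theta, c.T_lsmul, mul_assoc]
  | zero =>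
    refine ⟨0, ?_, by rw [map_zero, mul_zero]⟩
    ext x
    exact ((𝒮.Delta r).map_zero).symm
  | add x y hx hy =>
    obtain ⟨x', hx1, hx2⟩ := hx
    obtain ⟨y', hy1, hy2⟩ := hy
    refine ⟨x' + y', ?_, by rw [map_add, map_add, mul_add, hx2, hy2]⟩
    rw [AddSubgroup.coe_add, hx1, hy1, AddSubgroup.coe_add, AddMonoidHom.comp_add]
  | neg x hx =>
    obtain ⟨x', hx1, hx2⟩ := hx
    refine ⟨-x', ?_, by rw [map_neg, map_neg, mul_neg, hx2]⟩
    rw [AddSubgroup.coe_neg, hx1, AddSubgroup.coe_neg]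
    ext z
    exact ((𝒮.Delta r).map_neg _).symm

theorem pi_mul_sigma [𝒮.FS] (Θ : 𝒮.finRank) (r : R) :
    ∃ h : Θ.1.comp (𝒮.Delta r) ∈ 𝒮.finRank, c.pi ⟨_, h⟩ = c.pi Θ * c.σ r := by
  suffices H : ∃ Θ' : 𝒮.finRank, Θ'.1 = Θ.1.comp (𝒮.Delta r) ∧ c.pi Θ' = c.pi Θ * c.σ r by
    obtain ⟨⟨Θ', h'⟩, h1, h2⟩ := H
    subst h1
    exact ⟨h', h2⟩
  induction Θ using finRank_induction with
  | theta e f =>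
    refine ⟨⟨_, theta_mem 𝒮 e (f <• r)⟩, (theta_comp_Delta r e f).symm, ?_⟩
    rw [pi_theta, pi_theta, c.S_rsmul, mul_assoc]
  | zero => exact ⟨0, rfl, by rw [map_zero, zero_mul]⟩
  | add x y hx hy =>
    obtain ⟨x', hx1, hx2⟩ := hx
    obtain ⟨y', hy1, hy2⟩ := hy
    refine ⟨x' + y', ?_, by rw [map_add, map_add, add_mul, hx2, hy2]⟩
    rw [AddSubgroup.coe_add, hx1, hy1, AddSubgroup.coe_add, AddMonoidHom.add_comp]
  | neg x hx =>
    obtain ⟨x', hx1, hx2⟩ := hx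
    refine ⟨-x', ?_, by rw [map_neg, map_neg, neg_mul, hx2]⟩
    rw [AddSubgroup.coe_neg, hx1, AddSubgroup.coe_neg]
    rfl

/-- Every element of `𝓕_Q(P)` is implemented on `S(P)` by right multiplication with an element of
`π(𝓕_P(Q))`. -/
theorem exists_S_mul_pi [𝒮.FS] {Ω : P →+ P} (hΩ : Ω ∈ 𝒮.finRankAdj) :
    ∃ Θ : 𝒮.finRank, ∀ p, c.S p * c.pi Θ = c.S (Ω p) := by
  induction hΩ using AddSubgroup.closure_induction with
  | mem x hx =>
    obtain ⟨e, f, rfl⟩ := hx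
    -- The witness for `θ_{e,f}` on `P` is `θ_{f,e}` on `Q`: `S(p) T(f) S(e) = σ(ψ(p ⊗ f)) S(e) =
    -- S(ψ(p ⊗ f) e)`.
    refine ⟨⟨_, theta_mem 𝒮 f e⟩, fun p => ?_⟩
    rw [pi_theta, ← mul_assoc, ← c.cov, ← c.S_lsmul]
    rfl
  | zero => exact ⟨0, fun p => by rw [map_zero, mul_zero, AddMonoidHom.zero_apply, map_zero]⟩
  | add x y _ _ hx hy =>
    obtain ⟨x', hx⟩ := hx
    obtain ⟨y', hy⟩ := hy
    exact ⟨x' + y', fun p => by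
      rw [map_add, mul_add, hx, hy, AddMonoidHom.add_apply, map_add]⟩
  | neg x _ hx =>
    obtain ⟨x', hx⟩ := hx
    exact ⟨-x', fun p => by rw [map_neg, mul_neg, hx, AddMonoidHom.neg_apply, map_neg]⟩

/-! ### Local units -/

/-- The elements `x` that are fixed by every left multiplier fixing suitable finitely many `T(q)`. -/
def leftFixed : AddSubgroup B where
  carrier := {x | ∃ s : Finset Q, ∀ b, (∀ q ∈ s, b * c.T q = c.T q) → b * x = x}
  zero_mem' := ⟨∅, fun b _ => mul_zero b⟩
  add_mem' := by
    classical
    rintro x y ⟨s, hs⟩ ⟨t, ht⟩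
    exact ⟨s ∪ t, fun b hb => by
      rw [mul_add, hs b fun q hq => hb q (Finset.mem_union_left _ hq),
        ht b fun q hq => hb q (Finset.mem_union_right _ hq)]⟩
  neg_mem' := by
    rintro x ⟨s, hs⟩
    exact ⟨s, fun b hb => by rw [mul_neg, hs b hb]⟩

/-- The elements `x` that are fixed by every right multiplier fixing suitable finitely many
`S(p)`. -/
def rightFixed : AddSubgroup B where
  carrier := {x | ∃ s : Finset P, ∀ b, (∀ p ∈ s, c.S p * b = c.S p) → x * b = x}
  zero_mem' := ⟨∅, fun b _ => zero_mul b⟩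
  add_mem' := by
    classical
    rintro x y ⟨s, hs⟩ ⟨t, ht⟩
    exact ⟨s ∪ t, fun b hb => by
      rw [add_mul, hs b fun q hq => hb q (Finset.mem_union_left _ hq),
        ht b fun q hq => hb q (Finset.mem_union_right _ hq)]⟩
  neg_mem' := by
    rintro x ⟨s, hs⟩
    exact ⟨s, fun b hb => by rw [neg_mul, hs b hb]⟩

theorem T_mem_leftFixed (q : Q) : c.T q ∈ c.leftFixed :=
  ⟨{q}, fun _ hb => hb q (Finset.mem_singleton_self q)⟩

theorem S_mem_rightFixed (p : P) : c.S p ∈ c.rightFixed :=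
  ⟨{p}, fun _ hb => hb p (Finset.mem_singleton_self p)⟩

variable {c}

theorem mul_mem_leftFixed {x : B} (hx : x ∈ c.leftFixed) (y : B) : x * y ∈ c.leftFixed := by
  obtain ⟨s, hs⟩ := hx
  exact ⟨s, fun b hb => by rw [← mul_assoc, hs b hb]⟩

theorem mul_mem_rightFixed {x : B} (hx : x ∈ c.rightFixed) (y : B) : y * x ∈ c.rightFixed := by
  obtain ⟨s, hs⟩ := hx
  exact ⟨s, fun b hb => by rw [mul_assoc, hs b hb]⟩

/-- By (FS) some `Θ` fixes the finitely many `q` that control `x`, and then `π(Θ)` fixes each `T(q)`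
by `pi_mul_T`. -/
theorem exists_pi_mul_eq [h𝒮 : 𝒮.FS] {x : B} (hx : x ∈ c.leftFixed) :
    ∃ Θ : 𝒮.finRank, c.pi Θ * x = x := by
  obtain ⟨s, hs⟩ := hx
  obtain ⟨Θ, hΘ, -, -, h, -⟩ := h𝒮.exists_finRank s ∅
  exact ⟨⟨Θ, hΘ⟩, hs _ fun q hq => by rw [pi_mul_T, h q hq]⟩

theorem exists_mul_pi_eq [h𝒮 : 𝒮.FS] {x : B} (hx : x ∈ c.rightFixed) :
    ∃ Θ : 𝒮.finRank, x * c.pi Θ = x := by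
  obtain ⟨s, hs⟩ := hx
  obtain ⟨-, -, Ω, hΩ, -, h⟩ := h𝒮.exists_finRank ∅ s
  obtain ⟨Θ, hΘ⟩ := c.exists_S_mul_pi hΩ
  exact ⟨Θ, hs _ fun p hp => by rw [hΘ, h p hp]⟩

theorem pi_mul_eq_zero [𝒮.FS] {x : B} (h : ∀ p, c.S p * x = 0) (Θ : 𝒮.finRank) :
    c.pi Θ * x = 0 := by
  induction Θ using finRank_induction with
  | theta q p => rw [pi_theta, mul_assoc, h, mul_zero]
  | zero => rw [map_zero, zero_mul]
  | add x y hx hy => rw [map_add, add_mul, hx, hy, add_zero]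
  | neg x hx => rw [map_neg, neg_mul, hx, neg_zero]

theorem mul_pi_eq_zero [𝒮.FS] {x : B} (h : ∀ q, x * c.T q = 0) (Θ : 𝒮.finRank) :
    x * c.pi Θ = 0 := by
  induction Θ using finRank_induction with
  | theta q p => rw [pi_theta, ← mul_assoc, h, zero_mul]
  | zero => rw [map_zero, mul_zero]
  | add x y hx hy => rw [map_add, mul_add, hx, hy, add_zero]
  | neg x hx => rw [map_neg, mul_neg, hx, neg_zero]

/-- The local unit `π(Θ)` of `x` is a signed sum of products `T(q) S(p)`, so it both fixes and kills
`x`. -/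
theorem eq_zero_of_S_mul [𝒮.FS] {x : B} (hx : x ∈ c.leftFixed) (h : ∀ p, c.S p * x = 0) :
    x = 0 := by
  obtain ⟨Θ, hΘ⟩ := exists_pi_mul_eq hx
  rw [← hΘ, pi_mul_eq_zero h]

theorem eq_zero_of_mul_T [𝒮.FS] {x : B} (hx : x ∈ c.rightFixed) (h : ∀ q, x * c.T q = 0) :
    x = 0 := by
  obtain ⟨Θ, hΘ⟩ := exists_mul_pi_eq hx
  rw [← hΘ, mul_pi_eq_zero h]

/-! ### Monomials -/

variable (c) in
/-- The monomials with `m` factors from `T(Q)` followed by `k` factors from `S(P)`; those with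
`m = k = 0` are the elements of `σ(R)`. -/
inductive IsMonomial : ℕ → ℕ → B → Prop
  | sigma (r : R) : IsMonomial 0 0 (c.σ r)
  | T (q : Q) : IsMonomial 1 0 (c.T q)
  | S (p : P) : IsMonomial 0 1 (c.S p)
  | T_mul {m k : ℕ} {b : B} (q : Q) (hb : IsMonomial m k b) : IsMonomial (m + 1) k (c.T q * b)
  | mul_S {m k : ℕ} {b : B} (p : P) (hb : IsMonomial m k b) : IsMonomial m (k + 1) (b * c.S p)

namespace IsMonomial

variable {m k : ℕ} {b : B}

theorem sigma_mul (hb : c.IsMonomial m k b) (r : R) : c.IsMonomial m k (c.σ r * b) := by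
  induction hb with
  | sigma s => rw [← map_mul]; exact .sigma _
  | T q => rw [← c.T_lsmul]; exact .T _
  | S p => rw [← c.S_lsmul]; exact .S _
  | T_mul q hb _ => rw [← mul_assoc, ← c.T_lsmul]; exact .T_mul _ hb
  | mul_S p _ ih => rw [← mul_assoc]; exact .mul_S _ ih

theorem mul_sigma (hb : c.IsMonomial m k b) (r : R) : c.IsMonomial m k (b * c.σ r) := by
  induction hb with
  | sigma s => rw [← map_mul]; exact .sigma _
  | T q => rw [← c.T_rsmul]; exact .T _
  | S p => rw [← c.S_rsmul]; exact .S _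
  | T_mul q _ ih => rw [mul_assoc]; exact .T_mul _ ih
  | mul_S p hb _ => rw [mul_assoc, ← c.S_rsmul]; exact .mul_S _ hb

/-- If `b` begins with a factor `T(q)`, then `S(p) T(q) = σ(ψ(p ⊗ q))` cancels it and the scalar is
absorbed by the rest; otherwise `S(p)` becomes one more `S`-factor. Both cases are proved together,
with equations on `m`, so that the induction can run over arbitrary indices. -/
theorem S_mul_zero_succ (hb : c.IsMonomial m k b) (p : P) :
    (m = 0 → c.IsMonomial 0 (k + 1) (c.S p * b)) ∧
      ∀ n, m = n + 1 → c.IsMonomial n k (c.S p * b) := by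
  induction hb with
  | sigma r => exact ⟨fun _ => by rw [← c.S_rsmul]; exact .S _, fun n hn => by omega⟩
  | T q =>
    refine ⟨fun h => by omega, fun n hn => ?_⟩
    obtain rfl : n = 0 := by omega
    rw [← c.cov]
    exact .sigma _
  | S p' => exact ⟨fun _ => .mul_S _ (.S _), fun n hn => by omega⟩
  | T_mul q hb _ =>
    refine ⟨fun h => by omega, fun n hn => ?_⟩
    obtain rfl := Nat.succ.inj hn
    rw [← mul_assoc, ← c.cov]
    exact hb.sigma_mul _
  | mul_S p' _ ih =>
    simp only [← mul_assoc]
    exact ⟨fun h => .mul_S _ (ih.1 h), fun n hn => .mul_S _ (ih.2 n hn)⟩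

theorem mul_T_zero_succ (hb : c.IsMonomial m k b) (q : Q) :
    (k = 0 → c.IsMonomial (m + 1) 0 (b * c.T q)) ∧
      ∀ n, k = n + 1 → c.IsMonomial m n (b * c.T q) := by
  induction hb with
  | sigma r => exact ⟨fun _ => by rw [← c.T_lsmul]; exact .T _, fun n hn => by omega⟩
  | S p =>
    refine ⟨fun h => by omega, fun n hn => ?_⟩
    obtain rfl : n = 0 := by omega
    rw [← c.cov]
    exact .sigma _
  | T q' => exact ⟨fun _ => .T_mul _ (.T _), fun n hn => by omega⟩
  | mul_S p hb _ =>
    refine ⟨fun h => by omega, fun n hn => ?_⟩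
    obtain rfl := Nat.succ.inj hn
    rw [mul_assoc, ← c.cov]
    exact hb.mul_sigma _
  | T_mul q' _ ih =>
    simp only [mul_assoc]
    exact ⟨fun h => .T_mul _ (ih.1 h), fun n hn => .T_mul _ (ih.2 n hn)⟩

theorem mem_leftFixed (hb : c.IsMonomial m k b) (hm : m ≠ 0) : b ∈ c.leftFixed := by
  induction hb with
  | sigma r => exact absurd rfl hm
  | T q => exact c.T_mem_leftFixed q
  | S p => exact absurd rfl hm
  | T_mul q _ _ => exact mul_mem_leftFixed (c.T_mem_leftFixed q) _
  | mul_S p _ ih => exact mul_mem_leftFixed (ih hm) _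

theorem mem_rightFixed (hb : c.IsMonomial m k b) (hk : k ≠ 0) : b ∈ c.rightFixed := by
  induction hb with
  | sigma r => exact absurd rfl hk
  | S p => exact c.S_mem_rightFixed p
  | T q => exact absurd rfl hk
  | mul_S p _ _ => exact mul_mem_rightFixed (c.S_mem_rightFixed p) _
  | T_mul q _ ih => exact mul_mem_rightFixed (ih hk) _

theorem mem_range_sigma (hb : c.IsMonomial m k b) (hm : m = 0) (hk : k = 0) :
    ∃ r, c.σ r = b := by
  cases hb with
  | sigma r => exact ⟨r, rfl⟩
  | T | S | T_mul | mul_S => omega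

end IsMonomial

/-! ### Homogeneous components -/

variable (c)

/-- The additive span of the monomials of degree `n`. -/
def homogeneous (n : ℤ) : AddSubgroup B :=
  AddSubgroup.closure {b | ∃ m k : ℕ, (m : ℤ) - k = n ∧ c.IsMonomial m k b}

/-- The additive span of the monomials with `m ≤ n` factors from `T(Q)` and `m` from `S(P)`. -/
def core (n : ℕ) : AddSubgroup B :=
  AddSubgroup.closure {b | ∃ m ≤ n, c.IsMonomial m m b}

variable {c}

theorem IsMonomial.S_mul_mem {m k : ℕ} {b : B} (hb : c.IsMonomial m k b) (p : P) :
    c.S p * b ∈ c.homogeneous ((m : ℤ) - k - 1) := by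
  obtain ⟨h0, h1⟩ := hb.S_mul_zero_succ p
  rcases m with - | m
  · exact AddSubgroup.subset_closure ⟨0, k + 1, by push_cast; ring, h0 rfl⟩
  · exact AddSubgroup.subset_closure ⟨m, k, by push_cast; ring, h1 m rfl⟩

theorem IsMonomial.mul_T_mem {m k : ℕ} {b : B} (hb : c.IsMonomial m k b) (q : Q) :
    b * c.T q ∈ c.homogeneous ((m : ℤ) - k + 1) := by
  obtain ⟨h0, h1⟩ := hb.mul_T_zero_succ q
  rcases k with - | k
  · exact AddSubgroup.subset_closure ⟨m + 1, 0, by push_cast; ring, h0 rfl⟩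
  · exact AddSubgroup.subset_closure ⟨m, k, by push_cast; ring, h1 k rfl⟩

theorem S_mul_mem_homogeneous {n : ℤ} {x : B} (hx : x ∈ c.homogeneous n) (p : P) :
    c.S p * x ∈ c.homogeneous (n - 1) := by
  have h : c.homogeneous n ≤ (c.homogeneous (n - 1)).comap (AddMonoidHom.mulLeft (c.S p)) := by
    refine (AddSubgroup.closure_le _).2 ?_
    rintro b ⟨m, k, rfl, hb⟩
    exact hb.S_mul_mem p
  exact h hx

theorem mul_T_mem_homogeneous {n : ℤ} {x : B} (hx : x ∈ c.homogeneous n) (q : Q) :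
    x * c.T q ∈ c.homogeneous (n + 1) := by
  have h : c.homogeneous n ≤ (c.homogeneous (n + 1)).comap (AddMonoidHom.mulRight (c.T q)) := by
    refine (AddSubgroup.closure_le _).2 ?_
    rintro b ⟨m, k, rfl, hb⟩
    exact hb.mul_T_mem q
  exact h hx

/-- Positive degree forces `m > k ≥ 0`, so every monomial involved begins with a factor from `T(Q)`.
-/
theorem homogeneous_le_leftFixed {n : ℤ} (hn : 0 < n) : c.homogeneous n ≤ c.leftFixed := by
  refine (AddSubgroup.closure_le _).2 ?_
  rintro b ⟨m, k, rfl, hb⟩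
  exact hb.mem_leftFixed (by omega)

theorem homogeneous_le_rightFixed {n : ℤ} (hn : n < 0) : c.homogeneous n ≤ c.rightFixed := by
  refine (AddSubgroup.closure_le _).2 ?_
  rintro b ⟨m, k, rfl, hb⟩
  exact hb.mem_rightFixed (by omega)

theorem core_mono : Monotone c.core := fun _ _ h =>
  AddSubgroup.closure_mono fun _ ⟨m, hm, hb⟩ => ⟨m, hm.trans h, hb⟩

theorem exists_mem_core {x : B} (hx : x ∈ c.homogeneous 0) : ∃ n, x ∈ c.core n := by
  unfold homogeneous at hx
  induction hx using AddSubgroup.closure_induction with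
  | mem b hb =>
    obtain ⟨m, k, h, hb⟩ := hb
    obtain rfl : m = k := by omega
    exact ⟨m, AddSubgroup.subset_closure ⟨m, le_rfl, hb⟩⟩
  | zero => exact ⟨0, zero_mem _⟩
  | add x y _ _ hx hy =>
    obtain ⟨a, ha⟩ := hx
    obtain ⟨b, hb⟩ := hy
    exact ⟨max a b, add_mem (core_mono (le_max_left a b) ha) (core_mono (le_max_right a b) hb)⟩
  | neg x _ hx =>
    obtain ⟨a, ha⟩ := hx
    exact ⟨a, neg_mem ha⟩

theorem core_zero_le : c.core 0 ≤ (c.σ : R →+ B).range := by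
  refine (AddSubgroup.closure_le _).2 ?_
  rintro b ⟨m, hm, hb⟩
  exact hb.mem_range_sigma (by omega) (by omega)

/-- A balanced monomial is either in `σ(R)` or begins with some `T(q)` and ends with some `S(p)`.
Only the `σ(R)` part may lack local units, which is where the covariance relation has to enter. -/
theorem core_le (n : ℕ) :
    c.core n ≤ (c.σ : R →+ B).range ⊔ (c.leftFixed ⊓ c.rightFixed) := by
  refine (AddSubgroup.closure_le _).2 ?_
  rintro b ⟨m, hm, hb⟩
  rcases eq_or_ne m 0 with h | h
  · exact AddSubgroup.mem_sup_left (hb.mem_range_sigma h h)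
  · exact AddSubgroup.mem_sup_right ⟨hb.mem_leftFixed h, hb.mem_rightFixed h⟩

/-- Compression strips one `T` and one `S` from a monomial with `m ≥ 1`, and sends `σ(r)` to `σ(ψ(p
r ⊗ q))`, which still has `m = 0`. -/
theorem S_mul_mul_T_mem_core {n : ℕ} {x : B} (hx : x ∈ c.core (n + 1)) (p : P) (q : Q) :
    c.S p * x * c.T q ∈ c.core n := by
  have h : c.core (n + 1) ≤ (c.core n).comap
      ((AddMonoidHom.mulRight (c.T q)).comp (AddMonoidHom.mulLeft (c.S p))) := by
    refine (AddSubgroup.closure_le _).2 ?_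
    rintro b ⟨m, hm, hb⟩
    change c.S p * b * c.T q ∈ c.core n
    rcases m with - | m
    · obtain ⟨r, rfl⟩ := hb.mem_range_sigma rfl rfl
      rw [← c.S_rsmul, ← c.cov]
      exact AddSubgroup.subset_closure ⟨0, n.zero_le, .sigma _⟩
    · exact AddSubgroup.subset_closure ⟨m, by omega,
        (((hb.S_mul_zero_succ p).2 m rfl).mul_T_zero_succ q).2 m rfl⟩
  exact h hx

/-! ### Injectivity on the homogeneous components -/

section Injectivity

variable {A : Type*} [NonUnitalRing A] {φ : B →ₙ+* A}

/-- If `T(q) = 0` then `σ(ψ(p ⊗ q)) = S(p) T(q) = 0` for all `p`, so `q` is orthogonal to `P`. -/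
theorem T_injective_of_sigma [𝒮.FS] (hφ : ∀ r, φ (c.σ r) = 0 → r = 0) {q : Q}
    (hq : c.T q = 0) : q = 0 :=
  eq_zero_of_psi_eq_zero fun p => hφ _ (by rw [c.cov, hq, mul_zero, map_zero])

/-- The heart of the argument. `hmax` is the form in which maximality of `J` enters: a covariance
relation that holds after applying `φ` already holds before. -/
theorem eq_zero_of_mem_core [𝒮.FS] (hφ : ∀ r, φ (c.σ r) = 0 → r = 0)
    (hmax : ∀ r (h : 𝒮.Delta r ∈ 𝒮.finRank), φ (c.σ r) = φ (c.pi ⟨_, h⟩) →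
      c.σ r = c.pi ⟨_, h⟩) (n : ℕ) {x : B} (hx : x ∈ c.core n) (h0 : φ x = 0) : x = 0 := by
  induction n generalizing x with
  | zero =>
    obtain ⟨r, rfl⟩ := core_zero_le hx
    change φ (c.σ r) = 0 at h0
    rw [hφ r h0, map_zero]
  | succ n ih =>
    -- The compressions lie one step lower in the filtration and still in the kernel.
    have hSxT : ∀ p q, c.S p * x * c.T q = 0 := fun p q =>
      ih (S_mul_mul_T_mem_core hx p q) (by rw [map_mul, map_mul, h0, mul_zero, zero_mul])
    obtain ⟨z, ⟨r, rfl⟩, y, ⟨hyl, hyr⟩, rfl⟩ := AddSubgroup.mem_sup.1 (core_le _ hx)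
    change φ (c.σ r + y) = 0 at h0
    change ∀ p q, c.S p * (c.σ r + y) * c.T q = 0 at hSxT
    change c.σ r + y = 0
    -- `σ(r)` need not have a left local unit, but `σ(r) T(q) = T(r q)` does, so `S(p)` can be
    -- cancelled after multiplying by `T(q)`.
    have hxT : ∀ q, (c.σ r + y) * c.T q = 0 := fun q => by
      refine eq_zero_of_S_mul (c := c) ?_ fun p => by rw [← mul_assoc, hSxT]
      rw [add_mul, ← c.T_lsmul]
      exact add_mem (c.T_mem_leftFixed _) (mul_mem_leftFixed hyl _)
    -- With `y π(Θ) = y`, the relation `(σ(r) + y) π(Θ) = 0` gives `y = -π(Δ(r) Θ)`.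
    obtain ⟨Θ, hΘ⟩ := exists_mul_pi_eq hyr
    obtain ⟨hr, hpi⟩ := c.sigma_mul_pi r Θ
    have hy : y = -c.pi ⟨_, hr⟩ := by
      have h := mul_pi_eq_zero hxT Θ
      rw [add_mul, hΘ, ← hpi] at h
      exact (neg_eq_of_add_eq_zero_right h).symm
    -- Substituting `y` into `hxT` gives `T(r q) = T(r Θ(q))`, and `T` is injective. Hence `Δ(r)`
    -- itself has finite rank and `y = -π(Δ(r))`.
    have hD : (𝒮.Delta r).comp Θ.1 = 𝒮.Delta r := by
      ext q
      have h := hxT q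
      rw [hy, add_mul, neg_mul, pi_mul_T, ← c.T_lsmul, ← sub_eq_add_neg, ← map_sub] at h
      exact (sub_eq_zero.1 (T_injective_of_sigma hφ h)).symm
    simp only [hD] at hy hr
    rw [hy, map_add, map_neg, ← sub_eq_add_neg, sub_eq_zero] at h0
    rw [hy, hmax r hr h0, add_neg_cancel]

/-- Multiplying by `S(p)` on the left lowers a positive degree, and by `T(q)` on the right raises a
negative one; both stay in the kernel, and local units allow cancelling them. Everything thus
reduces to degree 0. -/
theorem eq_zero_of_mem_homogeneous [𝒮.FS] (hφ : ∀ r, φ (c.σ r) = 0 → r = 0)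
    (hmax : ∀ r (h : 𝒮.Delta r ∈ 𝒮.finRank), φ (c.σ r) = φ (c.pi ⟨_, h⟩) →
      c.σ r = c.pi ⟨_, h⟩) (n : ℤ) {x : B} (hx : x ∈ c.homogeneous n) (h0 : φ x = 0) :
    x = 0 := by
  induction n using Int.induction_on generalizing x with
  | zero =>
    obtain ⟨n, hn⟩ := exists_mem_core hx
    exact eq_zero_of_mem_core hφ hmax n hn h0
  | succ n ih =>
    refine eq_zero_of_S_mul (homogeneous_le_leftFixed (by omega) hx) fun p => ih ?_ ?_
    · simpa using S_mul_mem_homogeneous hx p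
    · rw [map_mul, h0, mul_zero]
  | pred n ih =>
    refine eq_zero_of_mul_T (homogeneous_le_rightFixed (by omega) hx) fun q => ih ?_ ?_
    · simpa using mul_T_mem_homogeneous hx q
    · rw [map_mul, h0, zero_mul]

end Injectivity

/-! ### Decomposition into homogeneous components -/

variable (c) in
/-- The additive span of all monomials. -/
def monomialSpan : AddSubgroup B :=
  AddSubgroup.closure {b | ∃ m k : ℕ, c.IsMonomial m k b}

theorem IsMonomial.mem_monomialSpan {m k : ℕ} {b : B} (hb : c.IsMonomial m k b) :
    b ∈ c.monomialSpan :=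
  AddSubgroup.subset_closure ⟨m, k, hb⟩

theorem mul_mem_monomialSpan_of_isMonomial {a : B}
    (h : ∀ m k b, c.IsMonomial m k b → a * b ∈ c.monomialSpan) {y : B}
    (hy : y ∈ c.monomialSpan) : a * y ∈ c.monomialSpan := by
  have h' : c.monomialSpan ≤ c.monomialSpan.comap (AddMonoidHom.mulLeft a) := by
    refine (AddSubgroup.closure_le _).2 ?_
    rintro b ⟨m, k, hb⟩
    exact h m k b hb
  exact h' hy

/-- Left multiplication by each of `σ(r)`, `T(q)` and `S(p)` preserves the span, and a monomial is a
product of such factors. -/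
theorem IsMonomial.mul_mem_monomialSpan {m k : ℕ} {b : B} (hb : c.IsMonomial m k b) {y : B}
    (hy : y ∈ c.monomialSpan) : b * y ∈ c.monomialSpan := by
  have hT : ∀ q {y}, y ∈ c.monomialSpan → c.T q * y ∈ c.monomialSpan := fun q _ =>
    mul_mem_monomialSpan_of_isMonomial fun m k b hb => (IsMonomial.T_mul q hb).mem_monomialSpan
  have hS : ∀ p {y}, y ∈ c.monomialSpan → c.S p * y ∈ c.monomialSpan := fun p _ =>
    mul_mem_monomialSpan_of_isMonomial fun m k b hb => by
      rcases m with - | m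
      · exact ((hb.S_mul_zero_succ p).1 rfl).mem_monomialSpan
      · exact ((hb.S_mul_zero_succ p).2 m rfl).mem_monomialSpan
  induction hb generalizing y with
  | sigma r =>
    exact mul_mem_monomialSpan_of_isMonomial
      (fun m k b hb => (hb.sigma_mul r).mem_monomialSpan) hy
  | T q => exact hT q hy
  | S p => exact hS p hy
  | T_mul q _ ih => rw [mul_assoc]; exact hT q (ih hy)
  | mul_S p _ ih => rw [mul_assoc]; exact ih (hS p hy)

theorem mul_mem_monomialSpan {x y : B} (hx : x ∈ c.monomialSpan) (hy : y ∈ c.monomialSpan) :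
    x * y ∈ c.monomialSpan := by
  have h : c.monomialSpan ≤ c.monomialSpan.comap (AddMonoidHom.mulRight y) := by
    refine (AddSubgroup.closure_le _).2 ?_
    rintro b ⟨m, k, hb⟩
    exact hb.mul_mem_monomialSpan hy
  exact h hx

/-- Existence of a decomposition suffices; the argument never needs the sum of the components to be
direct. -/
theorem exists_homogeneous_sum {x : B} (hx : x ∈ c.monomialSpan) :
    ∃ f : ℤ →₀ B, (∀ n, f n ∈ c.homogeneous n) ∧ f.sum (fun _ b => b) = x := by
  classical
  unfold monomialSpan at hx
  induction hx using AddSubgroup.closure_induction with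
  | mem b hb =>
    obtain ⟨m, k, hb⟩ := hb
    refine ⟨Finsupp.single ((m : ℤ) - k) b, fun n => ?_, Finsupp.sum_single_index rfl⟩
    rw [Finsupp.single_apply]
    split_ifs with h
    · exact AddSubgroup.subset_closure ⟨m, k, h, hb⟩
    · exact zero_mem _
  | zero => exact ⟨0, fun n => zero_mem _, Finsupp.sum_zero_index⟩
  | add x y _ _ hx hy =>
    obtain ⟨f, hf, rfl⟩ := hx
    obtain ⟨g, hg, rfl⟩ := hy
    exact ⟨f + g, fun n => add_mem (hf n) (hg n),
      Finsupp.sum_add_index' (fun _ => rfl) fun _ _ _ => rfl⟩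
  | neg x _ hx =>
    obtain ⟨f, hf, rfl⟩ := hx
    exact ⟨-f, fun n => neg_mem (hf n), by
      rw [Finsupp.sum_neg_index (fun _ => rfl), ← Finsupp.sum_neg]⟩

theorem monomialSpan_map_toeplitzRep (f : 𝒮.Toeplitz →ₙ+* B) (x : 𝒮.Toeplitz) :
    f x ∈ (𝒮.toeplitzRep.map f).monomialSpan := by
  induction x using Toeplitz.induction with
  | R r => exact (IsMonomial.sigma (c := 𝒮.toeplitzRep.map f) r).mem_monomialSpan
  | P p => exact (IsMonomial.S (c := 𝒮.toeplitzRep.map f) p).mem_monomialSpan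
  | Q q => exact (IsMonomial.T (c := 𝒮.toeplitzRep.map f) q).mem_monomialSpan
  | zero => rw [map_zero]; exact zero_mem _
  | add x y hx hy => rw [map_add]; exact add_mem hx hy
  | neg x hx => rw [map_neg]; exact neg_mem hx
  | mul x y hx hy => rw [map_mul]; exact mul_mem_monomialSpan hx hy

end CovRep

/-! ### The gauge action on the homogeneous components -/

/-- A Laurent polynomial with vector coefficients that vanishes on `Fˣ` is zero, for infinite
`F`. -/
theorem eq_zero_of_forall_zpow_smul_sum {F V : Type*} [Field F] [Infinite F] [AddCommGroup V]
    [Module F V] (f : ℤ →₀ V)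
    (h : ∀ t : Fˣ, f.sum (fun n v => ((t ^ n : Fˣ) : F) • v) = 0) (n : ℤ) : f n = 0 := by
  classical
  rw [← Module.forall_dual_apply_eq_zero_iff F]
  intro ℓ
  -- Multiplying by `t^N` clears the negative exponents, so that after applying the functional `ℓ`
  -- an ordinary polynomial remains, with every nonzero `t` as a root.
  obtain ⟨N, hN⟩ : ∃ N : ℕ, ∀ n ∈ f.support, 0 ≤ n + N := by
    obtain ⟨M, hM⟩ := f.support.bddBelow
    exact ⟨M.natAbs, fun n hn => by have := hM hn; omega⟩
  let p : Polynomial F := ∑ n ∈ f.support, Polynomial.monomial (n + N).toNat (ℓ (f n))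
  have hp : p = 0 := by
    refine Polynomial.eq_zero_of_infinite_isRoot p
      ((Set.finite_singleton (0 : F)).infinite_compl.mono fun t ht => ?_)
    have ht0 : t ≠ 0 := ht
    have h1 := congrArg (fun v => t ^ N * ℓ v) (h (Units.mk0 t ht0))
    simp only [Finsupp.sum, map_sum, map_zero, mul_zero, Finset.mul_sum] at h1
    change p.eval t = 0
    rw [Polynomial.eval_finsetSum, ← h1]
    refine Finset.sum_congr rfl fun n hn => ?_
    rw [Polynomial.eval_monomial, map_smul, smul_eq_mul, Units.val_zpow_eq_zpow_val,
      Units.val_mk0, ← mul_assoc, ← zpow_natCast t N, ← zpow_add₀ ht0, ← zpow_natCast t,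
      Int.toNat_of_nonneg (hN n hn), add_comm, mul_comm]
  by_cases hn : n ∈ f.support
  · have h2 := congrArg (Polynomial.coeff · (n + N).toNat) hp
    simp only [p, Polynomial.finsetSum_coeff, Polynomial.coeff_monomial,
      Polynomial.coeff_zero] at h2
    -- Truncation by `toNat` merges no exponents, since `k + N ≥ 0` on the support.
    rw [Finset.sum_eq_single n (fun k hk hkn => if_neg fun e => hkn (by
      have := hN k hk
      have := hN n hn
      omega)) fun h => absurd hn h, if_pos rfl] at h2
    exact h2
  · rw [Finsupp.notMem_support_iff.1 hn, map_zero]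

section Gauge

variable {F : Type*} [Field F]
  [Module F R] [IsScalarTower F R R] [SMulCommClass F R R]
  [Module F P] [IsScalarTower F R P] [SMulCommClass F R P]
  [IsScalarTower F Rᵐᵒᵖ P] [SMulCommClass F Rᵐᵒᵖ P]
  [Module F Q] [IsScalarTower F R Q] [SMulCommClass F R Q]
  [IsScalarTower F Rᵐᵒᵖ Q] [SMulCommClass F Rᵐᵒᵖ Q] [𝒮.FS]

/-- The representation `(ι_P^J, ι_Q^J, ι_R^J)`. -/
noncomputable def relCPRep (𝒮 : RSystem R P Q) [𝒮.FS] (J : TwoSidedIdeal R) :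
    𝒮.CovRep (𝒮.RelCP J) :=
  𝒮.toeplitzRep.map (𝒮.rho J)

variable (J : TwoSidedIdeal R) [IsSMulStable F J]

/-- Each factor from `P` contributes `t` and each factor from `Q` contributes `t⁻¹`. -/
theorem gauge_isMonomial (t : Fˣ) {m k : ℕ} {b : 𝒮.RelCP J}
    (hb : (𝒮.relCPRep J).IsMonomial m k b) :
    (𝒮.gauge F J t).1 b = ((t ^ ((k : ℤ) - m) : Fˣ) : F) • b := by
  induction hb with
  | sigma r => exact (𝒮.gauge_R J t r).trans (by simp; rfl)
  | T q => exact (𝒮.gauge_Q J t q).trans (by simp; rfl)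
  | S p => exact (𝒮.gauge_P J t p).trans (by simp; rfl)
  | @T_mul m k b q _ ih =>
    have h : (k : ℤ) - (m + 1 : ℕ) = -1 + ((k : ℤ) - m) := by push_cast; ring
    rw [map_mul, ih, h, zpow_add, zpow_neg_one, Units.val_mul, mul_smul, mul_smul_comm]
    exact (congrArg (_ • · ) (congrArg (· * b) (𝒮.gauge_Q J t q))).trans
      (by rw [smul_mul_assoc, smul_comm]; rfl)
  | @mul_S m k b p _ ih =>
    have h : ((k + 1 : ℕ) : ℤ) - m = 1 + ((k : ℤ) - m) := by push_cast; ring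
    rw [map_mul, ih, h, zpow_add, zpow_one, Units.val_mul, mul_smul, smul_mul_assoc]
    exact (congrArg (_ • · ) (congrArg (b * ·) (𝒮.gauge_P J t p))).trans
      (by rw [mul_smul_comm, smul_comm]; rfl)

theorem gauge_homogeneous (t : Fˣ) {n : ℤ} {x : 𝒮.RelCP J}
    (hx : x ∈ (𝒮.relCPRep J).homogeneous n) :
    (𝒮.gauge F J t).1 x = ((t ^ (-n) : Fˣ) : F) • x := by
  unfold CovRep.homogeneous at hx
  induction hx using AddSubgroup.closure_induction with
  | mem b hb =>
    obtain ⟨m, k, rfl, hb⟩ := hb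
    rw [gauge_isMonomial J t hb, neg_sub]
  | zero => rw [map_zero, smul_zero]
  | add x y _ _ hx hy => rw [map_add, hx, hy, smul_add]
  | neg x _ hx => rw [map_neg, hx, smul_neg]

variable {A : Type*} [NonUnitalRing A] [Module F A] [IsScalarTower F A A] [SMulCommClass F A A]

/-- The homogeneous components of an element of a gauge-invariant kernel lie in the kernel. -/
theorem apply_homogeneous_eq_zero [Infinite F] (φ : 𝒮.RelCP J →ₙₐ[F] A)
    (hgauge : ∀ (t : Fˣ) x, φ x = 0 → φ ((𝒮.gauge F J t).1 x) = 0) (f : ℤ →₀ 𝒮.RelCP J)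
    (hf : ∀ n, f n ∈ (𝒮.relCPRep J).homogeneous n) (h0 : φ (f.sum fun _ b => b) = 0) (n : ℤ) :
    φ (f n) = 0 := by
  have h := eq_zero_of_forall_zpow_smul_sum (F := F) (f.mapRange φ (map_zero φ)) (fun t => by
    -- Degree `n` is scaled by `t^(-n)`, so the inverse parameter produces the coefficient `t^n`.
    have h1 := hgauge t⁻¹ _ h0
    rw [Finsupp.sum, map_sum, map_sum] at h1
    rw [Finsupp.sum_mapRange_index (fun n => smul_zero _), Finsupp.sum, ← h1]
    refine Finset.sum_congr rfl fun n _ => ?_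
    rw [gauge_homogeneous J _ (hf n), map_smul, inv_zpow, zpow_neg, inv_inv]) n
  rwa [Finsupp.mapRange_apply] at h

/-- The ideal of those `r` with `Δ(r) ∈ 𝓕_P(Q)` and `φ(ι_R(r)) = φ(π(Δ(r)))`. -/
def covarianceIdeal {A : Type*} [NonUnitalRing A] (𝒮 : RSystem R P Q) [𝒮.FS]
    (c : 𝒮.CovRep A) : TwoSidedIdeal R :=
  .mk' {r | ∃ Θ : 𝒮.finRank, Θ.1 = 𝒮.Delta r ∧ c.σ r = c.pi Θ}
    ⟨0, Delta_zero.symm, by rw [map_zero, map_zero]⟩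
    (by
      rintro x y ⟨Θ, h1, h2⟩ ⟨Θ', h1', h2'⟩
      exact ⟨Θ + Θ', by rw [Delta_add, ← h1, ← h1']; rfl, by rw [map_add, map_add, h2, h2']⟩)
    (by
      rintro x ⟨Θ, h1, h2⟩
      exact ⟨-Θ, by rw [Delta_neg, ← h1]; rfl, by rw [map_neg, map_neg, h2]⟩)
    (by
      rintro x y ⟨Θ, h1, h2⟩
      -- Absorption: `σ(x y) = σ(x) π(Θ) = π(Δ(x) Θ)` and `Δ(x) Θ = Δ(x y)`.
      obtain ⟨h, e⟩ := c.sigma_mul_pi x Θ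
      exact ⟨⟨_, h⟩, by rw [Delta_mul, ← h1], by rw [e, map_mul, h2]⟩)
    (by
      rintro x y ⟨Θ, h1, h2⟩
      obtain ⟨h, e⟩ := c.pi_mul_sigma Θ y
      exact ⟨⟨_, h⟩, by rw [Delta_mul, ← h1], by rw [e, map_mul, h2]⟩)

theorem mem_covarianceIdeal {A : Type*} [NonUnitalRing A] {c : 𝒮.CovRep A} {r : R} :
    r ∈ 𝒮.covarianceIdeal c ↔ ∃ Θ : 𝒮.finRank, Θ.1 = 𝒮.Delta r ∧ c.σ r = c.pi Θ :=
  TwoSidedIdeal.mem_mk' _ _ _ _ _ _ r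

/-- If `Δ(r) = 0`, the covariance relation reads `σ(r) = π(0) = 0`, and injectivity of `σ` gives
faithfulness. -/
theorem isFaithfulCompatible_covarianceIdeal {A : Type*} [NonUnitalRing A] {c : 𝒮.CovRep A}
    (hc : ∀ r, c.σ r = 0 → r = 0) : 𝒮.IsFaithfulCompatible (𝒮.covarianceIdeal c) := by
  refine ⟨fun r hr => ?_, fun r hr h0 => ?_⟩
  · obtain ⟨Θ, h, -⟩ := mem_covarianceIdeal.1 hr
    exact h ▸ Θ.2
  · obtain ⟨Θ, h, e⟩ := mem_covarianceIdeal.1 hr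
    obtain rfl : Θ = 0 := Subtype.ext (h.trans h0)
    exact hc r (by rw [e, map_zero])

theorem relCPRep_sigma_eq_pi {r : R} (hr : r ∈ J) (h : 𝒮.Delta r ∈ 𝒮.finRank) :
    (𝒮.relCPRep J).σ r = (𝒮.relCPRep J).pi ⟨_, h⟩ := by
  rw [relCPRep, CovRep.map_pi, ← sub_eq_zero]
  change 𝒮.rho J _ - _ = 0
  rw [← map_sub]
  exact (idealMk_eq_zero _).2 (TwoSidedIdeal.subset_span ⟨r, hr, h, rfl⟩)

/-- Gauge-invariant uniqueness for `𝒪_{(P,Q,ψ)}(J)`, with `J` maximal among the `F`-stable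
faithful `ψ`-compatible ideals. -/
theorem injective_of_gauge_invariant [Infinite F] (hJ : 𝒮.IsCompatible J)
    (hmax : ∀ J' : TwoSidedIdeal R, IsSMulStable F J' → 𝒮.IsFaithfulCompatible J' → J ≤ J' →
      J' ≤ J)
    (φ : 𝒮.RelCP J →ₙₐ[F] A) (hφ : ∀ r : R, r ≠ 0 → φ (𝒮.iotaR J r) ≠ 0)
    (hgauge : ∀ (t : Fˣ) x, φ x = 0 → φ ((𝒮.gauge F J t).1 x) = 0) :
    Function.Injective φ := by
  let φ' : 𝒮.RelCP J →ₙ+* A := φ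
  let c := (𝒮.relCPRep J).map φ'
  have hR : ∀ r, φ' ((𝒮.relCPRep J).σ r) = 0 → r = 0 := fun r h =>
    not_ne_iff.1 fun h' => hφ r h' h
  -- `J` competes only with ideals that are `F`-subspaces. Stability here comes from the
  -- `F`-linearity of `φ`, `ι_R^J` and `π`.
  have hstable : IsSMulStable F (𝒮.covarianceIdeal c) := ⟨fun a r hr => by
    obtain ⟨Θ, h1, h2⟩ := mem_covarianceIdeal.1 hr
    obtain ⟨h3, h4⟩ := pi_smul a Θ.1 Θ.2
    refine mem_covarianceIdeal.2 ⟨⟨_, h3⟩, by rw [smul_Delta, ← h1], ?_⟩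
    change φ (𝒮.iotaR J (a • r)) = _
    change φ (𝒮.iotaR J r) = _ at h2
    rw [iotaR_smul, map_smul, h2, CovRep.map_pi, CovRep.map_pi, relCPRep, CovRep.map_pi,
      CovRep.map_pi, h4, rho_smul]
    exact (map_smul φ a _).symm⟩
  have hle : J ≤ 𝒮.covarianceIdeal c := fun r hr =>
    mem_covarianceIdeal.2 ⟨⟨_, hJ r hr⟩, rfl, by
      rw [CovRep.map_pi, ← relCPRep_sigma_eq_pi J hr]; rfl⟩
  -- Maximality: every covariance relation visible in `A` comes from an element of `J`.
  have hge := hmax _ hstable (isFaithfulCompatible_covarianceIdeal hR) hle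
  rw [injective_iff_map_eq_zero]
  intro x hx
  obtain ⟨y, rfl⟩ := rho_surjective J x
  obtain ⟨f, hf, hsum⟩ := CovRep.exists_homogeneous_sum
    (CovRep.monomialSpan_map_toeplitzRep (𝒮.rho J) y)
  rw [← hsum] at hx ⊢
  refine Finset.sum_eq_zero fun n _ => ?_
  refine CovRep.eq_zero_of_mem_homogeneous (φ := φ') hR (fun r h e => ?_) n (hf n)
    (apply_homogeneous_eq_zero J φ hgauge f hf hx n)
  -- A relation holding under `φ` puts `r` into `J`, and for `r ∈ J` it was imposed in forming
  -- `𝒪(J)`.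
  refine relCPRep_sigma_eq_pi J (hge (mem_covarianceIdeal.2 ⟨⟨_, h⟩, rfl, ?_⟩)) h
  rw [CovRep.map_pi]
  exact e

end Gauge

end RSystem

theorem corollary6 {F R P Q : Type*} [Field F] [Infinite F]
    [NonUnitalRing R] [Module F R] [IsScalarTower F R R] [SMulCommClass F R R]
    [AddCommGroup P] [NUBimodule R P] [Module F P]
    [IsScalarTower F R P] [SMulCommClass F R P] [IsScalarTower F Rᵐᵒᵖ P] [SMulCommClass F Rᵐᵒᵖ P]
    [AddCommGroup Q] [NUBimodule R Q] [Module F Q]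
    [IsScalarTower F R Q] [SMulCommClass F R Q] [IsScalarTower F Rᵐᵒᵖ Q] [SMulCommClass F Rᵐᵒᵖ Q]
    (𝒮 : RSystem R P Q) [𝒮.FS]
    {A : Type*} [NonUnitalRing A] [Module F A] [IsScalarTower F A A] [SMulCommClass F A A] :
    (∀ (J : TwoSidedIdeal R) [RSystem.IsSMulStable F J], 𝒮.IsMaximalFaithful F J →
      ∀ (φ : 𝒮.RelCP J →ₙₐ[F] A), (∀ r : R, r ≠ 0 → φ (𝒮.iotaR J r) ≠ 0) →
      ∀ (σ : Fˣ →* RSystem.AlgAut F A),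
        (∀ (t : Fˣ) (x : 𝒮.RelCP J), φ ((𝒮.gauge F J t).1 x) = (σ t).1 (φ x)) →
        Function.Injective φ) ∧
    (∀ (h : ∃ J, 𝒮.IsUniquelyMaximal J)
      (φ : 𝒮.CuntzPimsner h →ₙₐ[F] A), (∀ r : R, r ≠ 0 → φ (𝒮.iotaR (𝒮.cpIdeal h) r) ≠ 0) →
      ∀ (σ : Fˣ →* RSystem.AlgAut F A),
        (∀ (t : Fˣ) (x : 𝒮.CuntzPimsner h),
          φ ((𝒮.gauge F (𝒮.cpIdeal h) t).1 x) = (σ t).1 (φ x)) →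
        Function.Injective φ) := by
  refine ⟨fun J _ hJ φ hφ σ hσ => ?_, fun h φ hφ σ hσ => ?_⟩
  -- Equivariance is needed only to make the kernel of `φ` gauge-invariant: `φ(τ_t x) = σ_t(0) = 0`.
  · exact RSystem.injective_of_gauge_invariant J hJ.1.1
      (fun J' hs hf hle => (hJ.2 J' hs hf hle).ge) φ hφ
      fun t x hx => by rw [hσ, hx, map_zero]
  · have hJ : 𝒮.IsUniquelyMaximal (𝒮.cpIdeal h) := h.choose_spec
    -- An ideal containing all faithful compatible ideals contains in particular those that are
    -- `F`-subspaces.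
    exact RSystem.injective_of_gauge_invariant (𝒮.cpIdeal h) hJ.1.1
      (fun J' _ hf _ => hJ.2 J' hf) φ hφ fun t x hx => by rw [hσ, hx, map_zero]
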